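/- For real $x,y>0$ let $S(x,y)$ denote the set of positive integers $m\le x$ all of whose prime factors $p$ satisfy $p\le y$. Assume the Generalized Riemann Hypothesis for Dirichlet $L$-functions: for every Dirichlet character $\chi$, every zero of $L(s,\chi)$ with $0<\operatorname{Re} s<1$ satisfies $\operatorname{Re} s=1/2$. Let $A>0$, $c>0$ and $\varepsilon>0$. Then there is a constant $C=C(A,c,\varepsilon)>0$ such that for all real $x>1$ and $y>0$ with $\log y\ge c(\log\log x)^2$, all integers $q$ with $1<q\le x^A$, and all non-principal Dirichlet characters $\chi$ modulo $q$, $$\Big|\sum_{m\in S(x,y)}\chi(m)\Big|\le C\,x^{1/2+\varepsilon}.$$ -/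

import Mathlib

/-- The Generalized Riemann Hypothesis for Dirichlet `L`-functions: for every modulus `q ≥ 1` and
every Dirichlet character `χ` modulo `q`, all zeros of (the analytic continuation of) `L(s, χ)` in
the open critical strip `0 < Re s < 1` lie on the line `Re s = 1/2`. -/
def GRH : Prop :=
  ∀ (q : ℕ) [NeZero q] (χ : DirichletCharacter ℂ q) (s : ℂ),
    0 < s.re → s.re < 1 → χ.LFunction s = 0 → s.re = 1 / 2

open Classical in
/-- `S(x, y)`: the positive integers `m ≤ x` such that every prime `p ∣ m` satisfies `p ≤ y`. -/
noncomputable def smoothSet (x y : ℝ) : Finset ℕ :=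
  {m ∈ Finset.Icc 1 ⌊x⌋₊ | ∀ p : ℕ, p.Prime → p ∣ m → (p : ℝ) ≤ y}

theorem mem_smoothSet {x y : ℝ} {m : ℕ} :
    m ∈ smoothSet x y ↔
      0 < m ∧ (m : ℝ) ≤ x ∧ ∀ p : ℕ, p.Prime → p ∣ m → (p : ℝ) ≤ y := by
  unfold smoothSet
  simp only [Finset.mem_filter, Finset.mem_Icc, and_assoc]
  constructor
  · rintro ⟨h1, h2, h3⟩
    exact ⟨h1, (Nat.le_floor_iff' (by omega)).1 h2, h3⟩
  · rintro ⟨h1, h2, h3⟩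
    exact ⟨h1, (Nat.le_floor_iff' (by omega)).2 h2, h3⟩

/-!
Why the bound holds. Let `L_y(s) = ∏_{p ≤ y} (1 - χ(p) p^(-s))⁻¹` be the Dirichlet series of `χ`
restricted to `y`-smooth integers. It is a finite product, holomorphic for `Re s > 0`, so a truncated
Perron formula moved to a line slightly to the right of `Re s = 1/2`
(`exists_norm_sum_le_of_continuation`) bounds the character sum by `x ^ (1/2 + 3η) (1 + log x)` times
the maximum of `|L_y|` for `1/2 + 3η ≤ Re s ≤ 2`, `|Im s| ≤ x³`. It remains to see that this maximum
is `O(x ^ η)`, which follows from `|L_y(s)| ≪ (q (|t| + 2)) ^ δ` for every `δ > 0`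
(`exists_norm_eulerProduct_le`), where `t = Im s`, since `q ≤ x ^ A`.

Up to a bounded factor, `log |L_y(s)|` is at most `|∑_{p ≤ y} χ(p) p^(-s)|`. Under GRH, `L(s, χ)` does
not vanish for `Re s > 1/2`, hence has a holomorphic logarithm on that half-plane. Partial summation
gives `|L(s, χ)| ≤ 2 q |s|` there, and Borel–Carathéodory turns this into
`log L(s, χ) = O(log (q (|t| + 2)))` for `Re s ≥ 1/2 + η`. Removing the prime powers gives the same
bound for the continuation of `∑ₚ χ(p) p^(-s)` (`exists_continuation_primeSeries_bound`), and the
Perron formula gives `∑_{p ≤ v} χ(p) p^(-it) ≪ v ^ (1/2 + 2η) log (q (|t| + 2))`. By partial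
summation the primes `p > m` contribute `O(m ^ (-η) log (q (|t| + 2)))` to `∑_{p ≤ y} χ(p) p^(-s)`,
while the primes `p ≤ m` contribute at most `m`; a large constant `m` makes the total at most
`δ log (q (|t| + 2)) + O(1)`, uniformly in `y` (`exists_norm_sum_primeCoeff_cpow_le`).
-/

namespace SmoothCharSum

open Complex MeasureTheory Set Filter Topology

/-! ### Riesz means as vertical integrals -/

lemma hasMellin_max_one_sub {s : ℂ} (hs : 0 < s.re) :
    HasMellin (fun v : ℝ => ((max (1 - v) 0 : ℝ) : ℂ)) s (1 / (s * (s + 1))) := by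
  have h1 := hasMellin_one_Ioc hs
  have h2 := hasMellin_cpow_Ioc 1 (s := s) (by simp; linarith)
  have h3 := hasMellin_sub h1.1 h2.1
  rw [h1.2, h2.2] at h3
  have hs0 : s ≠ 0 := by rintro rfl; simp at hs
  have hs1 : s + 1 ≠ 0 := by
    intro h; have := congrArg Complex.re h; simp at this; linarith
  have e : 1 / s - 1 / (s + 1) = 1 / (s * (s + 1)) := by field_simp; ring
  rw [e] at h3
  have key : ∀ v ∈ Ioi (0:ℝ), ((Ioc 0 1).indicator (fun _ => (1:ℂ)) v -
      (Ioc 0 1).indicator (fun t : ℝ => (t:ℂ) ^ (1:ℂ)) v) = ((max (1 - v) 0 : ℝ) : ℂ) := by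
    intro v hv
    have hv' : 0 < v := hv
    by_cases h : v ≤ 1
    · have hm : v ∈ Ioc (0:ℝ) 1 := ⟨hv', h⟩
      rw [indicator_of_mem hm, indicator_of_mem hm, max_eq_left (by linarith)]
      simp
    · have hm : v ∉ Ioc (0:ℝ) 1 := fun h' => h h'.2
      rw [indicator_of_notMem hm, indicator_of_notMem hm, max_eq_right (by linarith)]
      simp
  refine ⟨?_, ?_⟩
  · refine (integrableOn_congr_fun (fun v hv => ?_) measurableSet_Ioi).1 h3.1
    simp only [key v hv]
  · rw [← h3.2]
    refine setIntegral_congr_fun measurableSet_Ioi fun v hv => ?_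
    simp only [key v hv]

lemma norm_le_norm_add_one {s : ℂ} (hs : 0 ≤ s.re) : ‖s‖ ≤ ‖s + 1‖ := by
  rw [← sq_le_sq₀ (norm_nonneg _) (norm_nonneg _), Complex.sq_norm, Complex.sq_norm,
    normSq_apply, normSq_apply]
  simp
  nlinarith

/-- On the line `Re s = 2` the kernel `1 / (s (s + 1))` is dominated by `1 / (1 + t²)`. -/
lemma norm_kernel_le (t : ℝ) :
    ‖1 / (((2:ℂ) + t * I) * ((2:ℂ) + t * I + 1))‖ ≤ (1 + t ^ 2)⁻¹ := by
  have h0 : ‖(2:ℂ) + t * I‖ ^ 2 = 4 + t ^ 2 := by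
    rw [Complex.sq_norm, normSq_apply]; simp; ring
  have h1 := norm_le_norm_add_one (s := (2:ℂ) + t * I) (by simp)
  rw [norm_div, norm_one, norm_mul, one_div]
  apply inv_anti₀ (by positivity)
  nlinarith [norm_nonneg ((2:ℂ) + t * I)]

lemma continuous_kernel :
    Continuous fun t : ℝ => 1 / (((2:ℂ) + t * I) * ((2:ℂ) + t * I + 1)) := by
  refine Continuous.div₀ continuous_const (by fun_prop) fun t => mul_ne_zero ?_ ?_
  · intro h; have := congrArg Complex.re h; simp at this
  · intro h; have := congrArg Complex.re h; norm_num at this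

lemma integrable_kernel :
    Integrable fun t : ℝ => 1 / (((2:ℂ) + t * I) * ((2:ℂ) + t * I + 1)) :=
  integrable_inv_one_add_sq.mono' continuous_kernel.aestronglyMeasurable
    (Eventually.of_forall norm_kernel_le)

/-- Mellin inversion for `v ↦ max (1 - v) 0`, on the line `Re s = 2`. -/
lemma integral_cpow_kernel {u : ℝ} (hu : 0 < u) :
    ∫ t : ℝ, (u : ℂ) ^ ((2:ℂ) + t * I) * (1 / (((2:ℂ) + t * I) * ((2:ℂ) + t * I + 1))) =
      2 * Real.pi * ((max (1 - u⁻¹) 0 : ℝ) : ℂ) := by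
  have hm : ∀ t : ℝ, mellin (fun v : ℝ => ((max (1 - v) 0 : ℝ) : ℂ)) ((2:ℝ) + t * I) =
      1 / (((2:ℂ) + t * I) * ((2:ℂ) + t * I + 1)) := fun t => by
    rw [(hasMellin_max_one_sub (by simp)).2]; norm_num
  have h := mellinInv_mellin_eq 2 (fun v : ℝ => ((max (1 - v) 0 : ℝ) : ℂ)) (inv_pos.2 hu)
    (hasMellin_max_one_sub (by simp)).1 ?_ ?_
  · rw [mellinInv] at h
    simp only [hm] at h
    have hpi : (Real.pi : ℂ) ≠ 0 := by exact_mod_cast Real.pi_ne_zero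
    rw [← h, real_smul]
    push_cast
    rw [show ∀ J : ℂ, 2 * (Real.pi : ℂ) * (1 / (2 * Real.pi) * J) = J from fun J => by field_simp]
    congr 1 with t
    rw [smul_eq_mul]
    congr 1
    rw [inv_cpow _ _ (by rw [arg_ofReal_of_nonneg hu.le]; exact Real.pi_pos.ne), cpow_neg, inv_inv]
  · unfold VerticalIntegrable
    simp only [hm]
    exact integrable_kernel
  · fun_prop

lemma norm_LSeries_term_two_le {a : ℕ → ℂ} (ha : ∀ n, ‖a n‖ ≤ 1) {s : ℂ} (hs : s.re = 2) (n : ℕ) :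
    ‖LSeries.term a s n‖ ≤ 1 / (n:ℝ) ^ 2 := by
  rw [LSeries.norm_term_eq, hs]
  split_ifs with h
  · positivity
  · rw [Real.rpow_two]; gcongr; exact ha n

/-- For bounded coefficients, the Riesz mean `∑ a(n) max (x - n, 0)` is the integral of the Dirichlet
series against `x ^ (s + 1) / (s (s + 1))` over `Re s = 2`. -/
lemma tsum_riesz {a : ℕ → ℂ} (ha : ∀ n, ‖a n‖ ≤ 1) (ha0 : a 0 = 0) {x : ℝ} (hx : 0 < x) :
    Integrable (fun t : ℝ => LSeries a ((2:ℂ) + t * I) * (x : ℂ) ^ ((2:ℂ) + t * I + 1) *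
      (1 / (((2:ℂ) + t * I) * ((2:ℂ) + t * I + 1)))) ∧
    ∫ t : ℝ, LSeries a ((2:ℂ) + t * I) * (x : ℂ) ^ ((2:ℂ) + t * I + 1) *
      (1 / (((2:ℂ) + t * I) * ((2:ℂ) + t * I + 1))) =
    2 * Real.pi * ∑ n ∈ Finset.Icc 1 ⌊x⌋₊, a n * ((x - n : ℝ) : ℂ) := by
  have hx0 : (x : ℂ) ≠ 0 := by exact_mod_cast hx.ne'
  let k : ℝ → ℂ := fun t => 1 / (((2:ℂ) + t * I) * ((2:ℂ) + t * I + 1))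
  let Φ : ℕ → ℝ → ℂ := fun n t => LSeries.term a ((2:ℂ) + t * I) n *
    ((x : ℂ) ^ ((2:ℂ) + t * I + 1)) * k t
  have hxn : ∀ t : ℝ, ‖(x : ℂ) ^ ((2:ℂ) + t * I + 1)‖ = x ^ 3 := fun t => by
    rw [norm_cpow_eq_rpow_re_of_pos hx]
    norm_num
  have hΦn : ∀ n t, ‖Φ n t‖ ≤ 1 / (n:ℝ) ^ 2 * (x ^ 3 * (1 + t ^ 2)⁻¹) := fun n t => by
    simp only [Φ]
    rw [norm_mul, norm_mul, hxn, mul_assoc]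
    gcongr
    · exact norm_LSeries_term_two_le ha (by simp) n
    · exact norm_kernel_le t
  have hΦc : ∀ n, Continuous (Φ n) := fun n => by
    refine Continuous.mul (Continuous.mul ?_ ?_) continuous_kernel
    · rcases eq_or_ne n 0 with rfl | hn
      · simp only [LSeries.term_zero]; exact continuous_const
      · simp only [LSeries.term_of_ne_zero hn]
        refine Continuous.div₀ continuous_const ?_ fun t => ?_
        · exact Continuous.const_cpow (by fun_prop) (Or.inl (by exact_mod_cast hn))
        · simp [cpow_eq_zero_iff, hn]
    · exact Continuous.const_cpow (by fun_prop) (Or.inl hx0)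
  have hdom : Integrable fun t : ℝ => x ^ 3 * (1 + t ^ 2)⁻¹ := integrable_inv_one_add_sq.const_mul _
  have hΦi : ∀ n, Integrable (Φ n) := fun n =>
    (hdom.const_mul (1 / (n:ℝ) ^ 2)).mono' (hΦc n).aestronglyMeasurable
      (Eventually.of_forall (hΦn n))
  have hsum2 : Summable fun n : ℕ => 1 / (n:ℝ) ^ 2 := Real.summable_one_div_nat_pow.2 (by norm_num)
  have hsumm : Summable fun n => ∫ t, ‖Φ n t‖ := by
    refine Summable.of_nonneg_of_le (fun n => integral_nonneg fun t => norm_nonneg _) (fun n => ?_)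
      (hsum2.mul_right (∫ t : ℝ, x ^ 3 * (1 + t ^ 2)⁻¹))
    rw [← integral_const_mul]
    exact integral_mono (hΦi n).norm (hdom.const_mul _) (hΦn n)
  have htsum : ∀ t, ∑' n, Φ n t = LSeries a ((2:ℂ) + t * I) * (x : ℂ) ^ ((2:ℂ) + t * I + 1) * k t :=
    fun t => by
      simp only [Φ]
      rw [tsum_mul_right, tsum_mul_right]; rfl
  have hH := hasSum_integral_of_summable_integral_norm hΦi hsumm
  simp only [htsum] at hH
  refine ⟨?_, ?_⟩
  · have hb : ∀ t, ‖∑' n, Φ n t‖ ≤ (∑' n : ℕ, 1 / (n:ℝ) ^ 2) * (x ^ 3 * (1 + t ^ 2)⁻¹) := fun t => by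
      rw [← tsum_mul_right]
      exact tsum_of_norm_bounded (hsum2.mul_right _).hasSum (fun n => hΦn n t)
    simp only [htsum] at hb
    refine (hdom.const_mul _).mono' ?_ (Eventually.of_forall hb)
    have := aestronglyMeasurable_of_tendsto_ae (μ := volume) atTop
      (f := fun (N : ℕ) t => ∑ n ∈ Finset.range N, Φ n t)
      (g := fun t => LSeries a ((2:ℂ) + t * I) * (x : ℂ) ^ ((2:ℂ) + t * I + 1) * k t)
      (fun N => (continuous_finsetSum _ fun n _ => hΦc n).aestronglyMeasurable)
      (Eventually.of_forall fun t => by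
        rw [← htsum]
        exact (Summable.of_norm_bounded (hsum2.mul_right _) (fun n => hΦn n t)).hasSum.tendsto_sum_nat)
    exact this
  · have hval : ∀ n : ℕ, ∫ t, Φ n t = 2 * Real.pi * (a n * ((max (x - n) 0 : ℝ) : ℂ)) := fun n => by
      rcases eq_or_ne n 0 with rfl | hn
      · simp [Φ, ha0]
      have hn' : (0:ℝ) < n := by exact_mod_cast Nat.pos_of_ne_zero hn
      have e : ∀ t, Φ n t = (a n * x) * (((x / n : ℝ) : ℂ) ^ ((2:ℂ) + t * I) * k t) := fun t => by
        simp only [Φ]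
        rw [LSeries.term_of_ne_zero hn, cpow_add _ _ hx0, cpow_one]
        rw [div_eq_mul_inv x, ofReal_mul, mul_cpow_ofReal_nonneg hx.le (inv_nonneg.2 hn'.le),
          ofReal_inv, ofReal_natCast, inv_cpow _ _ (by rw [natCast_arg]; exact Real.pi_pos.ne)]
        ring
      simp only [e]
      rw [integral_const_mul, integral_cpow_kernel (by positivity)]
      have : max (x - n) 0 = x * max (1 - (x / n)⁻¹) 0 := by
        rw [mul_max_of_nonneg _ _ hx.le]
        congr 1
        · field_simp
        · simp
      rw [this]; push_cast; ring
    rw [← hH.tsum_eq]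
    simp only [hval]
    rw [tsum_mul_left, tsum_eq_sum (s := Finset.Icc 1 ⌊x⌋₊)]
    · congr 1
      refine Finset.sum_congr rfl fun n hn => ?_
      have : (n:ℝ) ≤ x := (Nat.le_floor_iff hx.le).1 (Finset.mem_Icc.1 hn).2
      rw [max_eq_left (by linarith)]
    · intro n hn
      rcases eq_or_ne n 0 with rfl | h0
      · simp [ha0]
      have : x < n := by
        rw [Finset.mem_Icc, not_and] at hn
        have := hn (Nat.one_le_iff_ne_zero.2 h0)
        exact (Nat.floor_lt hx.le).1 (not_le.1 this)
      rw [max_eq_right (by linarith)]; simp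

/-! ### A truncated Perron formula -/

/-- The kernel of the difference of the Riesz means at `x + h` and at `x`. -/
noncomputable def diffKernel (x h : ℝ) (s : ℂ) : ℂ :=
  (((x + h : ℝ) : ℂ) ^ (s + 1) - (x : ℂ) ^ (s + 1)) * (1 / (s * (s + 1)))

/-- Bound linear in `h`, used at small height on the line `Re s = σ₀`. -/
lemma norm_diffKernel_le {x h : ℝ} (hx : 0 < x) (hh : 0 ≤ h) {s : ℂ} (hs : 0 < s.re) :
    ‖diffKernel x h s‖ ≤ h * (x + h) ^ s.re / ‖s‖ := by
  have hs0 : s ≠ 0 := by rintro rfl; simp at hs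
  have hs1 : s + 1 ≠ 0 := by
    intro h; have := congrArg Complex.re h; simp at this; linarith
  have hder : ∀ v ∈ Icc x (x + h), HasDerivWithinAt (fun v : ℝ => (v : ℂ) ^ (s + 1) / (s + 1))
      ((v : ℂ) ^ s) (Icc x (x + h)) v := fun v hv => by
    have := hasDerivAt_ofReal_cpow_const' (x := v) (r := s) (by linarith [hv.1]) (by
      intro h; rw [h] at hs; norm_num at hs)
    exact this.hasDerivWithinAt
  have hb : ∀ v ∈ Icc x (x + h), ‖(v : ℂ) ^ s‖ ≤ (x + h) ^ s.re := fun v hv => by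
    rw [norm_cpow_eq_rpow_re_of_pos (by linarith [hv.1])]
    exact Real.rpow_le_rpow (by linarith [hv.1]) hv.2 hs.le
  have := (convex_Icc x (x + h)).norm_image_sub_le_of_norm_hasDerivWithin_le hder hb
    (left_mem_Icc.2 (by linarith)) (right_mem_Icc.2 (by linarith))
  rw [show x + h - x = h by ring, Real.norm_of_nonneg hh] at this
  have e : diffKernel x h s =
      (((x + h : ℝ) : ℂ) ^ (s + 1) / (s + 1) - (x : ℂ) ^ (s + 1) / (s + 1)) / s := by
    unfold diffKernel; field_simp
  rw [e, norm_div]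
  gcongr
  linarith

/-- Bound with quadratic decay in `s`, used at large height. -/
lemma norm_diffKernel_le' {x h : ℝ} (hx : 0 < x) (hh : 0 ≤ h) {s : ℂ} (hs : 0 < s.re) :
    ‖diffKernel x h s‖ ≤ 2 * (x + h) ^ (s.re + 1) / ‖s‖ ^ 2 := by
  have hs0 : 0 < ‖s‖ := norm_pos_iff.2 (by rintro rfl; simp at hs)
  have h1 : ‖((x + h : ℝ) : ℂ) ^ (s + 1) - (x : ℂ) ^ (s + 1)‖ ≤ 2 * (x + h) ^ (s.re + 1) := by
    refine (norm_sub_le _ _).trans ?_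
    rw [norm_cpow_eq_rpow_re_of_pos (by linarith), norm_cpow_eq_rpow_re_of_pos hx]
    have : x ^ (s.re + 1) ≤ (x + h) ^ (s.re + 1) :=
      Real.rpow_le_rpow hx.le (by linarith) (by linarith)
    simp only [add_re, one_re]; linarith
  unfold diffKernel
  rw [norm_mul, norm_div, norm_one, norm_mul, mul_one_div, sq]
  have := norm_le_norm_add_one hs.le
  gcongr

lemma differentiableAt_diffKernel {x h : ℝ} (hx : 0 < x) (hh : 0 ≤ h) {s : ℂ} (hs : 0 < s.re) :
    DifferentiableAt ℂ (diffKernel x h) s := by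
  have hs0 : s ≠ 0 := by rintro rfl; simp at hs
  have hs1 : s + 1 ≠ 0 := by
    intro h; have := congrArg Complex.re h; simp at this; linarith
  have h1 : (x : ℂ) ≠ 0 := by exact_mod_cast hx.ne'
  have h2 : ((x + h : ℝ) : ℂ) ≠ 0 := by exact_mod_cast (by linarith : x + h ≠ 0)
  unfold diffKernel
  refine DifferentiableAt.mul (DifferentiableAt.sub ?_ ?_) ?_
  · exact DifferentiableAt.const_cpow (by fun_prop) (Or.inl h2)
  · exact DifferentiableAt.const_cpow (by fun_prop) (Or.inl h1)
  · exact DifferentiableAt.div (by fun_prop) (by fun_prop) (mul_ne_zero hs0 hs1)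

/-- Differencing the Riesz means at `x` and `x + h` recovers the sharp sum up to `h (h + 1)`. -/
lemma norm_mul_sum_sub_riesz_le {a : ℕ → ℂ} (ha : ∀ n, ‖a n‖ ≤ 1) {x h : ℝ} (hx : 0 < x)
    (hh : 0 ≤ h) :
    ‖h * ∑ n ∈ Finset.Icc 1 ⌊x⌋₊, a n -
      (∑ n ∈ Finset.Icc 1 ⌊x + h⌋₊, a n * ((x + h - n : ℝ) : ℂ) -
        ∑ n ∈ Finset.Icc 1 ⌊x⌋₊, a n * ((x - n : ℝ) : ℂ))‖ ≤ h * (h + 1) := by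
  have hle : ⌊x⌋₊ ≤ ⌊x + h⌋₊ := Nat.floor_le_floor (by linarith)
  have hsplit : ∑ n ∈ Finset.Icc 1 ⌊x + h⌋₊, a n * ((x + h - n : ℝ) : ℂ) =
      ∑ n ∈ Finset.Icc 1 ⌊x⌋₊, a n * ((x + h - n : ℝ) : ℂ) +
      ∑ n ∈ Finset.Ioc ⌊x⌋₊ ⌊x + h⌋₊, a n * ((x + h - n : ℝ) : ℂ) := by
    rw [← Finset.sum_union]
    · congr 1; ext n; simp only [Finset.mem_Icc, Finset.mem_Ioc, Finset.mem_union]; omega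
    · rw [Finset.disjoint_left]; intro n; simp only [Finset.mem_Icc, Finset.mem_Ioc]; omega
  have e : (h : ℂ) * ∑ n ∈ Finset.Icc 1 ⌊x⌋₊, a n -
      (∑ n ∈ Finset.Icc 1 ⌊x + h⌋₊, a n * ((x + h - n : ℝ) : ℂ) -
        ∑ n ∈ Finset.Icc 1 ⌊x⌋₊, a n * ((x - n : ℝ) : ℂ)) =
      - ∑ n ∈ Finset.Ioc ⌊x⌋₊ ⌊x + h⌋₊, a n * ((x + h - n : ℝ) : ℂ) := by
    rw [hsplit, Finset.mul_sum, add_sub_right_comm, ← Finset.sum_sub_distrib, ← sub_sub,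
      ← Finset.sum_sub_distrib, Finset.sum_eq_zero, zero_sub]
    intro n _; push_cast; ring
  rw [e, norm_neg]
  have hterm : ∀ n ∈ Finset.Ioc ⌊x⌋₊ ⌊x + h⌋₊, ‖a n * ((x + h - n : ℝ) : ℂ)‖ ≤ h := fun n hn => by
    rw [Finset.mem_Ioc] at hn
    have h1 : x < n := (Nat.floor_lt hx.le).1 hn.1
    have h2 : (n:ℝ) ≤ x + h := (Nat.le_floor_iff (by linarith)).1 hn.2
    rw [norm_mul, norm_real, Real.norm_of_nonneg (by linarith)]
    calc ‖a n‖ * (x + h - n) ≤ 1 * (x + h - n) := by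
          refine mul_le_mul_of_nonneg_right ?_ (by linarith)
          exact ha n
      _ ≤ h := by linarith
  refine (norm_sum_le_of_le _ hterm).trans ?_
  rw [Finset.sum_const, Nat.card_Ioc, nsmul_eq_mul, mul_comm, Nat.cast_sub hle]
  gcongr
  have := Nat.floor_le (by linarith : 0 ≤ x + h)
  have := Nat.lt_floor_add_one x
  linarith

lemma one_add_abs_le {σ : ℝ} (hσ : 1 / 2 ≤ σ) (t : ℝ) : 1 + |t| ≤ 4 * ‖(σ : ℂ) + t * I‖ := by
  have h1 := abs_re_le_norm ((σ : ℂ) + t * I)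
  have h2 := abs_im_le_norm ((σ : ℂ) + t * I)
  simp at h1 h2
  have := le_abs_self σ
  linarith [abs_nonneg t]

lemma integral_inv_one_add_abs {T : ℝ} (hT : 0 ≤ T) :
    ∫ t in (-T)..T, (1 + |t|)⁻¹ = 2 * Real.log (1 + T) := by
  have hc : Continuous fun t : ℝ => (1 + |t|)⁻¹ :=
    Continuous.inv₀ (by fun_prop) fun t => by positivity
  have hpos : ∫ t in (0:ℝ)..T, (1 + |t|)⁻¹ = Real.log (1 + T) := by
    have : ∫ t in (0:ℝ)..T, (1 + |t|)⁻¹ = ∫ t in (0:ℝ)..T, (1 + t)⁻¹ := by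
      refine intervalIntegral.integral_congr fun t ht => ?_
      rw [uIcc_of_le hT] at ht
      simp only [abs_of_nonneg ht.1]
    rw [this, intervalIntegral.integral_comp_add_left (fun t => t⁻¹) 1,
      integral_inv_of_pos (by norm_num) (by linarith)]
    simp
  have hneg : ∫ t in (-T)..0, (1 + |t|)⁻¹ = ∫ t in (0:ℝ)..T, (1 + |t|)⁻¹ := by
    have := intervalIntegral.integral_comp_neg (fun t : ℝ => (1 + |t|)⁻¹) (a := 0) (b := T)
    simp only [abs_neg, neg_zero] at this
    exact this.symm
  rw [← intervalIntegral.integral_add_adjacent_intervals (hc.intervalIntegrable _ _)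
    (hc.intervalIntegrable 0 T), hneg, hpos]
  ring

/-- A function of size `C / t²` has integral at most `2 C / T` outside `[-T, T]`. -/
lemma norm_integral_sub_le {f : ℝ → ℂ} (hf : Integrable f) {C T : ℝ} (hT : 0 < T)
    (hb : ∀ t, T < |t| → ‖f t‖ ≤ C / t ^ 2) :
    ‖(∫ t, f t) - ∫ t in (-T)..T, f t‖ ≤ 2 * C / T := by
  have tail : ∀ g : ℝ → ℂ, (∀ t, T < t → ‖g t‖ ≤ C / t ^ 2) → ‖∫ t in Ioi T, g t‖ ≤ C / T := by
    intro g hg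
    have hi : IntegrableOn (fun t : ℝ => C * t ^ (-2:ℝ)) (Ioi T) :=
      (integrableOn_Ioi_rpow_of_lt (by norm_num) hT).const_mul C
    have := norm_integral_le_of_norm_le hi (f := g) <|
      (ae_restrict_iff' measurableSet_Ioi).2 <| Eventually.of_forall fun t ht => by
        have ht' : T < t := ht
        rw [Real.rpow_neg (by linarith), Real.rpow_two, ← div_eq_mul_inv]
        exact hg t ht'
    refine this.trans (le_of_eq ?_)
    rw [integral_const_mul, integral_Ioi_rpow_of_lt (by norm_num) hT]
    rw [show (-2:ℝ) + 1 = -1 by norm_num, Real.rpow_neg_one]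
    field_simp
  have h1 := intervalIntegral.integral_Iic_sub_Iic (μ := volume) (f := f) (a := -T) (b := T)
    hf.integrableOn hf.integrableOn
  have h2 := intervalIntegral.integral_Iic_add_Ioi (μ := volume) (f := f) (b := T)
    hf.integrableOn hf.integrableOn
  have h3 := integral_comp_neg_Ioi T f
  rw [← h1, ← h2, ← h3]
  rw [show ∀ u v w : ℂ, u + v - (u - w) = v + w from fun u v w => by ring]
  have t1 := tail f fun t ht => hb t (ht.trans_le (le_abs_self t))
  have t2 := tail (fun t => f (-t)) fun t ht => by
    have := hb (-t) (by rw [abs_neg]; exact ht.trans_le (le_abs_self t))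
    rwa [neg_sq] at this
  calc _ ≤ C / T + C / T := (norm_add_le _ _).trans (add_le_add t1 t2)
    _ = 2 * C / T := by ring

set_option maxHeartbeats 800000 in
/-- **Truncated Perron formula with a shift of contour.** If the Dirichlet series of a sequence
bounded by `1` continues holomorphically to `σ₀ ≤ Re s ≤ 2`, `|Im s| ≤ x³`, with a bound `M` there,
then its partial sum up to `x` is `O(√x + M x ^ σ₀ (1 + log x))`. -/
theorem exists_norm_sum_le_of_continuation : ∃ K : ℝ, 0 < K ∧ ∀ (a : ℕ → ℂ) (F : ℂ → ℂ)
    (σ₀ x M : ℝ), (∀ n, ‖a n‖ ≤ 1) → a 0 = 0 → 1 / 2 ≤ σ₀ → σ₀ ≤ 1 → 1 ≤ x → 0 ≤ M →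
    (∀ s : ℂ, s.re = 2 → F s = LSeries a s) →
    (∀ s : ℂ, σ₀ ≤ s.re → s.re ≤ 2 → |s.im| ≤ x ^ 3 → DifferentiableAt ℂ F s) →
    (∀ s : ℂ, σ₀ ≤ s.re → s.re ≤ 2 → |s.im| ≤ x ^ 3 → ‖F s‖ ≤ M) →
    ‖∑ n ∈ Finset.Icc 1 ⌊x⌋₊, a n‖ ≤ K * (√x + M * x ^ σ₀ * (1 + Real.log x)) := by
  have hsum2 : Summable fun n : ℕ => 1 / (n:ℝ) ^ 2 := Real.summable_one_div_nat_pow.2 (by norm_num)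
  set Z : ℝ := ∑' n : ℕ, 1 / (n:ℝ) ^ 2 with hZ
  have hZ0 : 0 ≤ Z := tsum_nonneg fun n => by positivity
  refine ⟨114 + 32 * Z, by positivity, ?_⟩
  intro a F σ₀ x M ha ha0 hσ hσ1 hx hM hFL hFd hFM
  have hx0 : 0 < x := by linarith
  -- a differencing step `√x` keeps the loss from smoothing below the target size
  set h := √x with hh
  have hh1 : 1 ≤ h := Real.one_le_sqrt.2 hx
  have hhx : h ≤ x := by rw [hh, Real.sqrt_le_left hx0.le]; nlinarith
  have hxh : 0 < x + h := by linarith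
  set T : ℝ := x ^ 3 with hT
  have hT1 : 1 ≤ T := one_le_pow₀ hx
  have hlog : 0 ≤ Real.log x := Real.log_nonneg hx
  set f : ℂ → ℂ := fun s => F s * diffKernel x h s with hf
  set A := ∑ n ∈ Finset.Icc 1 ⌊x⌋₊, a n with hA
  have hpow3 : (x + h) ^ (3:ℝ) ≤ 8 * x ^ 3 := by
    rw [show (3:ℝ) = ((3:ℕ):ℝ) by norm_num, Real.rpow_natCast]
    calc (x + h) ^ 3 ≤ (2 * x) ^ 3 := by gcongr; linarith
      _ = 8 * x ^ 3 := by ring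
  obtain ⟨i1, e1⟩ := tsum_riesz ha ha0 hx0
  obtain ⟨i2, e2⟩ := tsum_riesz ha ha0 hxh
  have efun : ∀ t : ℝ, f ((2:ℝ) + t * I) =
      LSeries a ((2:ℂ) + t * I) * ((x + h : ℝ) : ℂ) ^ ((2:ℂ) + t * I + 1) *
      (1 / (((2:ℂ) + t * I) * ((2:ℂ) + t * I + 1))) -
      LSeries a ((2:ℂ) + t * I) * (x : ℂ) ^ ((2:ℂ) + t * I + 1) *
      (1 / (((2:ℂ) + t * I) * ((2:ℂ) + t * I + 1))) := fun t => by
    simp only [hf, diffKernel, ofReal_ofNat]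
    rw [hFL _ (by simp)]; ring
  have hint : Integrable fun t : ℝ => f ((2:ℝ) + t * I) := by
    simp only [efun]; exact i2.sub i1
  have hval : ‖2 * Real.pi * (h * A) - ∫ t : ℝ, f ((2:ℝ) + t * I)‖ ≤
      2 * Real.pi * (h * (h + 1)) := by
    simp only [efun]
    rw [integral_sub i2 i1, e1, e2, ← mul_sub, ← mul_sub, norm_mul]
    have : ‖(2 * Real.pi : ℂ)‖ = 2 * Real.pi := by
      rw [norm_mul, norm_real, Real.norm_of_nonneg Real.pi_pos.le]; norm_num
    rw [this]
    gcongr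
    exact norm_mul_sum_sub_riesz_le ha hx0 (by linarith)
  -- on `Re s = 2` the kernel is `O(x³ / t²)`, so cutting at height `T = x³` costs `O(1)`
  have htail : ‖(∫ t : ℝ, f ((2:ℝ) + t * I)) - ∫ t in (-T)..T, f ((2:ℝ) + t * I)‖ ≤ 32 * Z := by
    have := norm_integral_sub_le hint (C := Z * (16 * x ^ 3)) (T := T) (by linarith) fun t ht => by
      have ht0 : 0 < |t| := by linarith
      have hre : ((2:ℝ) + t * I : ℂ).re = 2 := by simp
      have him : |t| ≤ ‖((2:ℝ) + t * I : ℂ)‖ := by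
        have := abs_im_le_norm ((2:ℝ) + t * I : ℂ); simpa using this
      have hL : ‖LSeries a ((2:ℝ) + t * I)‖ ≤ Z :=
        tsum_of_norm_bounded hsum2.hasSum fun n => norm_LSeries_term_two_le ha hre n
      have hk := norm_diffKernel_le' hx0 (by linarith : 0 ≤ h) (s := (2:ℝ) + t * I) (by rw [hre]; norm_num)
      rw [hre] at hk
      simp only [hf]
      rw [hFL _ hre, norm_mul, mul_div_assoc, ← sq_abs t]
      refine mul_le_mul hL (hk.trans ?_) (norm_nonneg _) hZ0
      rw [show (2:ℝ) + 1 = 3 by norm_num]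
      have : 2 * (x + h) ^ (3:ℝ) ≤ 16 * x ^ 3 := by linarith
      gcongr
    refine this.trans (le_of_eq ?_)
    rw [hT]; field_simp; ring
  -- move the segment to `Re s = σ₀`; the only pole of the kernel with `Re s > -1` is at `s = 0`,
  -- outside the rectangle
  have hrect := integral_boundary_rect_eq_zero_of_differentiableOn f (σ₀ - T * I) (2 + T * I) (by
    intro s hs
    rw [mem_reProdIm] at hs
    simp only [sub_re, ofReal_re, mul_re, I_re, mul_zero, ofReal_im, I_im, mul_one, sub_self, sub_zero,
      add_re, re_ofNat, add_zero, sub_im, mul_im, zero_sub, add_im, im_ofNat, zero_add] at hs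
    rw [uIcc_of_le (by linarith), uIcc_of_le (by linarith)] at hs
    exact ((hFd s hs.1.1 hs.1.2 (abs_le.2 hs.2)).mul
      (differentiableAt_diffKernel hx0 (by linarith) (by linarith [hs.1.1]))).differentiableWithinAt)
  simp only [sub_re, ofReal_re, mul_re, I_re, mul_zero, ofReal_im, I_im, mul_one, sub_self, sub_zero,
      add_re, re_ofNat, add_zero, sub_im, mul_im, zero_sub, add_im, im_ofNat, zero_add] at hrect
  have hhor : ∀ τ : ℝ, |τ| = T → ‖∫ u in σ₀..2, f (u + τ * I)‖ ≤ 32 * M := fun τ hτ => by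
    have := intervalIntegral.norm_integral_le_of_norm_le_const (a := σ₀) (b := 2) (C := 16 * M)
      (f := fun u : ℝ => f (u + τ * I)) fun u hu => by
        rw [uIoc_of_le (by linarith)] at hu
        have hre : (u + τ * I : ℂ).re = u := by simp
        have him : (u + τ * I : ℂ).im = τ := by simp
        have hTn : T ≤ ‖(u + τ * I : ℂ)‖ := by
          have := abs_im_le_norm (u + τ * I : ℂ); rwa [him, hτ] at this
        have hk := norm_diffKernel_le' hx0 (by linarith : 0 ≤ h) (s := u + τ * I)
          (by rw [hre]; linarith [hu.1])
        rw [hre] at hk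
        have hk2 : 2 * (x + h) ^ (u + 1) / ‖(u + τ * I : ℂ)‖ ^ 2 ≤ 16 := by
          rw [div_le_iff₀ (pow_pos (by linarith) 2)]
          have : (x + h) ^ (u + 1) ≤ (x + h) ^ (3:ℝ) :=
            Real.rpow_le_rpow_of_exponent_le (by linarith) (by linarith [hu.2])
          have : T ^ 2 ≤ ‖(u + τ * I : ℂ)‖ ^ 2 := by gcongr
          nlinarith
        simp only [hf]
        rw [norm_mul, mul_comm]
        exact mul_le_mul (hk.trans hk2) (hFM _ (by rw [hre]; exact hu.1.le) (by rw [hre]; exact hu.2)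
          (by rw [him, hτ])) (norm_nonneg _) (by norm_num)
    refine this.trans ?_
    rw [abs_of_nonneg (by linarith)]
    nlinarith
  have hleft : ‖∫ y in (-T)..T, f (σ₀ + y * I)‖ ≤ 48 * (M * h * x ^ σ₀ * (1 + Real.log x)) := by
    have hci : IntervalIntegrable (fun t : ℝ => 8 * (M * h * x ^ σ₀) * (1 + |t|)⁻¹) volume (-T) T := by
      refine (Continuous.mul continuous_const ?_).intervalIntegrable _ _
      exact Continuous.inv₀ (by fun_prop) fun t => by positivity
    have := intervalIntegral.norm_integral_le_of_norm_le (μ := volume) (a := -T) (b := T)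
      (f := fun y : ℝ => f (σ₀ + y * I)) (by linarith) (Eventually.of_forall fun t ht => by
        have hre : (σ₀ + t * I : ℂ).re = σ₀ := by simp
        have him : (σ₀ + t * I : ℂ).im = t := by simp
        have hk := norm_diffKernel_le hx0 (by linarith : 0 ≤ h) (s := σ₀ + t * I)
          (by rw [hre]; linarith)
        rw [hre] at hk
        have h2x : (x + h) ^ σ₀ ≤ 2 * x ^ σ₀ := by
          calc (x + h) ^ σ₀ ≤ (2 * x) ^ σ₀ := by
                apply Real.rpow_le_rpow <;> linarith
            _ = 2 ^ σ₀ * x ^ σ₀ := Real.mul_rpow (by norm_num) hx0.le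
            _ ≤ 2 ^ (1:ℝ) * x ^ σ₀ := by gcongr; norm_num
            _ = 2 * x ^ σ₀ := by rw [Real.rpow_one]
        have hpos : 0 < 1 + |t| := by positivity
        have hn := one_add_abs_le hσ t
        have hinv : ‖(σ₀ + t * I : ℂ)‖⁻¹ ≤ 4 * (1 + |t|)⁻¹ := by
          rw [← div_eq_mul_inv, le_div_iff₀ hpos, inv_mul_le_iff₀ (by linarith)]; linarith
        simp only [hf]
        rw [norm_mul]
        calc _ ≤ M * (h * (2 * x ^ σ₀) * (4 * (1 + |t|)⁻¹)) := by
              refine mul_le_mul (hFM _ hre.ge (by rw [hre]; linarith) ?_) (hk.trans ?_)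
                (norm_nonneg _) hM
              · rw [him, abs_le]; exact ⟨ht.1.le, ht.2⟩
              · rw [div_eq_mul_inv]; gcongr
          _ = 8 * (M * h * x ^ σ₀) * (1 + |t|)⁻¹ := by ring) hci
    refine this.trans ?_
    rw [intervalIntegral.integral_const_mul, integral_inv_one_add_abs (by linarith)]
    have hl : Real.log (1 + T) ≤ 3 * (1 + Real.log x) := by
      calc Real.log (1 + T) ≤ Real.log (2 * x ^ 3) := Real.log_le_log (by positivity) (by linarith)
        _ = Real.log 2 + 3 * Real.log x := by
          rw [Real.log_mul (by norm_num) (by positivity), Real.log_pow]; norm_num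
        _ ≤ _ := by linarith [Real.log_two_lt_d9]
    calc 8 * (M * h * x ^ σ₀) * (2 * Real.log (1 + T)) ≤
          8 * (M * h * x ^ σ₀) * (2 * (3 * (1 + Real.log x))) := by gcongr
      _ = _ := by ring
  have hmain : ‖∫ t in (-T)..T, f ((2:ℝ) + t * I)‖ ≤
      64 * M + 48 * (M * h * x ^ σ₀ * (1 + Real.log x)) := by
    have e : I * ∫ t in (-T)..T, f ((2:ℝ) + t * I) =
        (∫ u in σ₀..2, f (u + T * I)) - (∫ u in σ₀..2, f (u + (-T : ℝ) * I)) +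
        I * ∫ y in (-T)..T, f (σ₀ + y * I) := by
      simp only [smul_eq_mul] at hrect
      push_cast at hrect ⊢
      linear_combination hrect
    have n1 : ‖I * ∫ t in (-T)..T, f ((2:ℝ) + t * I)‖ = ‖∫ t in (-T)..T, f ((2:ℝ) + t * I)‖ := by
      rw [norm_mul, norm_I, one_mul]
    rw [← n1, e]
    refine (norm_add_le _ _).trans (add_le_add ((norm_sub_le _ _).trans ?_) ?_)
    · have := hhor T (abs_of_nonneg (by linarith))
      have := hhor (-T) (by rw [abs_neg]; exact abs_of_nonneg (by linarith))
      linarith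
    · rw [norm_mul, norm_I, one_mul]; exact hleft
  -- everything so far is `h` times the claim; divide by `h = √x`, which also bounds the error `h + 1`
  have hfin : 2 * Real.pi * (h * ‖A‖) ≤ 2 * Real.pi * (h * (h + 1)) + 32 * Z +
      (64 * M + 48 * (M * h * x ^ σ₀ * (1 + Real.log x))) := by
    have hn : ‖(2 * Real.pi * (h * A) : ℂ)‖ = 2 * Real.pi * (h * ‖A‖) := by
      rw [norm_mul, norm_mul, norm_mul, norm_real, norm_real, Real.norm_of_nonneg Real.pi_pos.le,
        Real.norm_of_nonneg (by linarith)]; norm_num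
    rw [← hn]
    calc _ = ‖(2 * Real.pi * (h * A) - ∫ t : ℝ, f ((2:ℝ) + t * I)) +
          ((∫ t : ℝ, f ((2:ℝ) + t * I)) - ∫ t in (-T)..T, f ((2:ℝ) + t * I)) +
          ∫ t in (-T)..T, f ((2:ℝ) + t * I)‖ := by congr 1; ring
      _ ≤ _ := (norm_add₃_le).trans (add_le_add (add_le_add hval htail) hmain)
  set Y := M * x ^ σ₀ * (1 + Real.log x) with hY
  have hMY : M ≤ Y := by
    have : 1 ≤ x ^ σ₀ := Real.one_le_rpow hx (by linarith)
    rw [hY, mul_assoc]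
    exact le_mul_of_one_le_right hM (by nlinarith)
  have hpi : 1 ≤ 2 * Real.pi := by linarith [Real.pi_gt_three]
  have h1 : h * ‖A‖ ≤ h * (h + 1) + 32 * Z + (64 * M + 48 * (h * Y)) := by
    have hD : 0 ≤ 32 * Z + (64 * M + 48 * (h * Y)) := by nlinarith
    have e : 48 * (M * h * x ^ σ₀ * (1 + Real.log x)) = 48 * (h * Y) := by rw [hY]; ring
    rw [e] at hfin
    have h3 : 2 * Real.pi * (h * ‖A‖ - h * (h + 1)) ≤ 32 * Z + (64 * M + 48 * (h * Y)) := by linarith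
    have h4 : h * ‖A‖ - h * (h + 1) ≤ 32 * Z + (64 * M + 48 * (h * Y)) := by
      by_contra! hcon
      nlinarith
    linarith
  have hY0 : 0 ≤ Y := hM.trans hMY
  have h5 : h * ‖A‖ ≤ h * ((114 + 32 * Z) * (h + Y)) := by
    refine h1.trans ?_
    have q1 : h ≤ h * h := le_mul_of_one_le_left (by linarith) hh1
    have q2 : Y ≤ h * Y := le_mul_of_one_le_left hY0 hh1
    have q3 : Z ≤ Z * (h * h) := le_mul_of_one_le_right hZ0 (by linarith)
    have q4 : 0 ≤ Z * (h * Y) := by positivity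
    rw [show h * ((114 + 32 * Z) * (h + Y)) = 114 * (h * h) + 114 * (h * Y) + 32 * (Z * (h * h)) +
      32 * (Z * (h * Y)) by ring]
    linarith
  exact le_of_mul_le_mul_left h5 (by linarith)

/-! ### Growth of `L(s, χ)` to the right of the critical line -/

section Growth

variable {q : ℕ} {χ : DirichletCharacter ℂ q}

variable (χ) in
/-- The summatory function of a Dirichlet character. -/
noncomputable def charSum (t : ℝ) : ℂ := ∑ k ∈ Finset.Icc 1 ⌊t⌋₊, χ (k : ZMod q)

lemma charSum_eq_zero {t : ℝ} (ht : t < 1) : charSum χ t = 0 := by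
  rw [charSum, Nat.floor_eq_zero.2 ht]; simp

lemma measurable_charSum : Measurable (charSum χ) :=
  (measurable_from_nat (f := fun n : ℕ => ∑ k ∈ Finset.Icc 1 n, χ (k : ZMod q))).comp
    Nat.measurable_floor

lemma mellin_charSum_eq (s : ℂ) :
    mellin (charSum χ) (-s) = ∫ t in Ioi (1:ℝ), charSum χ t * (t : ℂ) ^ (-(s + 1)) := by
  rw [mellin, ← integral_Ici_eq_integral_Ioi (x := (1:ℝ)), eq_comm]
  have : ∀ t ∈ Ioi (0:ℝ) \ Ici 1, (t : ℂ) ^ (-s - 1) • charSum χ t = 0 := fun t ht => by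
    rw [charSum_eq_zero (by simpa using ht.2), smul_zero]
  rw [setIntegral_eq_of_subset_of_forall_sdiff_eq_zero measurableSet_Ioi
    (fun t ht => lt_of_lt_of_le one_pos ht) this]
  refine setIntegral_congr_fun measurableSet_Ici fun t _ => ?_
  simp only [smul_eq_mul]
  rw [mul_comm]; congr 2; ring

variable [NeZero q]

lemma sum_range_block_eq_zero (hχ : χ ≠ 1) (N : ℕ) :
    ∑ i ∈ Finset.range q, χ ((N + i : ℕ) : ZMod q) = 0 := by
  have h1 : ∑ i ∈ Finset.range q, χ ((N + i : ℕ) : ZMod q) = ∑ b : ZMod q, χ (N + b) := by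
    refine Finset.sum_bij' (fun i _ => ((i : ℕ) : ZMod q)) (fun b _ => b.val) ?_ ?_ ?_ ?_ ?_
    · intros; simp
    · intro b _; exact Finset.mem_range.2 (ZMod.val_lt b)
    · intro i hi; exact ZMod.val_cast_of_lt (Finset.mem_range.1 hi)
    · intro b _; simp
    · intros; push_cast; rfl
  rw [h1, Fintype.sum_equiv (Equiv.addLeft (N : ZMod q)) (fun b => χ (N + b)) χ (fun _ => rfl)]
  exact MulChar.sum_eq_zero_of_ne_one hχ

lemma norm_sum_range_character_le (hχ : χ ≠ 1) (N : ℕ) :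
    ‖∑ i ∈ Finset.range N, χ (i : ZMod q)‖ ≤ q := by
  induction N using Nat.strong_induction_on with
  | _ N ih =>
    rcases lt_or_ge N q with h | h
    · refine (norm_sum_le_of_le _ fun i _ => χ.norm_le_one _).trans ?_
      simp; exact_mod_cast h.le
    · obtain ⟨m, rfl⟩ := Nat.exists_eq_add_of_le' h
      rw [Finset.sum_range_add, sum_range_block_eq_zero hχ, add_zero]
      exact ih m (by have := NeZero.pos q; omega)

lemma norm_sum_Icc_character_le (hq : 1 < q) (hχ : χ ≠ 1) (N : ℕ) :
    ‖∑ i ∈ Finset.Icc 1 N, χ (i : ZMod q)‖ ≤ q := by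
  have : ∑ i ∈ Finset.Icc 1 N, χ (i : ZMod q) = ∑ i ∈ Finset.range (N + 1), χ (i : ZMod q) := by
    have : Nontrivial (ZMod q) := ZMod.nontrivial_iff.2 (by omega)
    rw [Finset.range_eq_Ico, Finset.sum_eq_sum_Ico_succ_bot (by omega)]
    simp only [Nat.cast_zero, MulChar.map_zero, zero_add]
    rfl
  rw [this]
  exact norm_sum_range_character_le hχ _

lemma differentiableAt_mellin_charSum (hq : 1 < q) (hχ : χ ≠ 1) {s : ℂ} (hs : s.re < 0) :
    DifferentiableAt ℂ (mellin (charSum χ)) s := by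
  refine mellin_differentiableAt_of_isBigO_rpow (a := 0) (b := s.re - 1) ?_ ?_ hs ?_ (by linarith)
  · refine LocallyIntegrable.locallyIntegrableOn ?_ _
    exact (locallyIntegrable_const (q : ℝ)).mono measurable_charSum.aestronglyMeasurable
      (Eventually.of_forall fun t => by
        rw [Real.norm_of_nonneg (Nat.cast_nonneg q)]; exact norm_sum_Icc_character_le hq hχ _)
  · simp only [neg_zero, Real.rpow_zero]
    exact Asymptotics.isBigO_of_le' (c := q) _ fun t => by
      rw [norm_one, mul_one]; exact norm_sum_Icc_character_le hq hχ _
  · refine Asymptotics.IsBigO.of_norm_eventuallyLE ?_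
    filter_upwards [Ioo_mem_nhdsGT (zero_lt_one' ℝ)] with t ht
    rw [charSum_eq_zero ht.2, norm_zero]
    exact Real.rpow_nonneg ht.1.le _

/-- Partial summation, continued to the half-plane `Re s > 0`. -/
lemma LFunction_eq_mul_mellin (hq : 1 < q) (hχ : χ ≠ 1) {s : ℂ} (hs : 0 < s.re) :
    χ.LFunction s = s * mellin (charSum χ) (-s) := by
  have hopen : IsOpen {s : ℂ | 0 < s.re} := isOpen_lt continuous_const continuous_re
  have hconv : Convex ℝ {s : ℂ | 0 < s.re} := convex_halfSpace_re_gt 0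
  have hd : DifferentiableOn ℂ (fun s => s * mellin (charSum χ) (-s)) {s : ℂ | 0 < s.re} :=
    fun s hs => by
      have h1 := differentiableAt_mellin_charSum hq hχ (s := -s) (by simpa using hs)
      have h2 : DifferentiableAt ℂ (fun s => mellin (charSum χ) (-s)) s :=
        DifferentiableAt.comp (g := mellin (charSum χ)) s h1 differentiableAt_id.neg
      exact (differentiableAt_id.mul h2).differentiableWithinAt
  have h1 := (DirichletCharacter.differentiable_LFunction hχ).differentiableOn
    (s := {s : ℂ | 0 < s.re}) |>.analyticOnNhd hopen
  refine h1.eqOn_of_preconnected_of_eventuallyEq (hd.analyticOnNhd hopen) hconv.isPreconnected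
    (z₀ := 2) (by simp) ?_ hs
  have : {s : ℂ | 1 < s.re} ∈ 𝓝 (2:ℂ) :=
    (isOpen_lt continuous_const continuous_re).mem_nhds (by simp)
  filter_upwards [this] with z hz
  have hz' : 1 < z.re := hz
  rw [DirichletCharacter.LFunction_eq_LSeries χ hz', mellin_charSum_eq]
  refine LSeries_eq_mul_integral _ le_rfl (by linarith)
    (DirichletCharacter.LSeriesSummable_of_one_lt_re χ hz') ?_
  simp only [Real.rpow_zero]
  exact Asymptotics.isBigO_of_le' (c := q) _ fun n => by
    rw [norm_one, mul_one]; exact norm_sum_Icc_character_le hq hχ _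

lemma norm_LFunction_le (hq : 1 < q) (hχ : χ ≠ 1) {s : ℂ} (hs : 1 / 2 ≤ s.re) :
    ‖χ.LFunction s‖ ≤ 2 * q * ‖s‖ := by
  rw [LFunction_eq_mul_mellin hq hχ (by linarith), mellin_charSum_eq, norm_mul, mul_comm]
  gcongr
  have hi : IntegrableOn (fun t : ℝ => q * t ^ (-(3 / 2) : ℝ)) (Ioi 1) :=
    (integrableOn_Ioi_rpow_of_lt (by norm_num) one_pos).const_mul _
  refine (norm_integral_le_of_norm_le hi <| (ae_restrict_iff' measurableSet_Ioi).2 <|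
    Eventually.of_forall fun t ht => ?_).trans (le_of_eq ?_)
  · have ht' : 1 < t := ht
    rw [norm_mul, norm_cpow_eq_rpow_re_of_pos (by linarith)]
    refine mul_le_mul (norm_sum_Icc_character_le hq hχ _) ?_ (by positivity) (by positivity)
    refine Real.rpow_le_rpow_of_exponent_le ht'.le ?_
    simp; linarith
  · rw [integral_const_mul, integral_Ioi_rpow_of_lt (by norm_num) one_pos]
    norm_num; ring

/-- Under GRH, `L(s, χ)` has no zero with `Re s > 1/2`. -/
lemma LFunction_ne_zero_of_GRH (hGRH : GRH) (hχ : χ ≠ 1) {s : ℂ} (hs : 1 / 2 < s.re) :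
    χ.LFunction s ≠ 0 := by
  rcases lt_or_ge s.re 1 with h | h
  · intro h0
    linarith [hGRH q χ s (by linarith) h h0]
  · exact χ.LFunction_ne_zero_of_one_le_re (Or.inl hχ) h

end Growth

/-! ### Holomorphic logarithms on a half-plane -/

/-- A nonvanishing holomorphic function on a disc has a holomorphic logarithm: a primitive of its
logarithmic derivative. -/
lemma exists_exp_eq_on_ball {f : ℂ → ℂ} {c : ℂ} {r : ℝ} (hf : DifferentiableOn ℂ f (Metric.ball c r))
    (h0 : ∀ z ∈ Metric.ball c r, f z ≠ 0) :
    ∃ g : ℂ → ℂ, DifferentiableOn ℂ g (Metric.ball c r) ∧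
      ∀ z ∈ Metric.ball c r, exp (g z) = f z := by
  rcases le_or_gt r 0 with hr | hr
  · exact ⟨0, by simp [Metric.ball_eq_empty.2 hr]⟩
  have hc : c ∈ Metric.ball c r := Metric.mem_ball_self hr
  have hld : DifferentiableOn ℂ (fun z => deriv f z / f z) (Metric.ball c r) :=
    (hf.deriv Metric.isOpen_ball).div hf h0
  obtain ⟨g, hgc, hg⟩ := hld.isExactOn_ball.with_val_at c (log (f c))
  have hgd : DifferentiableOn ℂ g (Metric.ball c r) :=
    fun z hz => (hg z hz).differentiableAt.differentiableWithinAt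
  refine ⟨g, hgd, fun z hz => ?_⟩
  have hder : ∀ w ∈ Metric.ball c r, HasDerivAt (fun w => exp (-g w) * f w) 0 w := fun w hw => by
    have h1 := ((hg w hw).neg.cexp).mul
      (hf.differentiableAt (Metric.isOpen_ball.mem_nhds hw)).hasDerivAt
    convert! h1 using 1
    have := h0 w hw
    field_simp
    ring
  have hconst := Metric.isOpen_ball.is_const_of_deriv_eq_zero
    (convex_ball c r).isPreconnected
    (fun w hw => (hder w hw).differentiableAt.differentiableWithinAt)
    (fun w hw => (hder w hw).deriv) hz hc
  simp only [hgc] at hconst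
  rw [exp_neg, exp_neg, exp_log (h0 c hc), inv_mul_cancel₀ (h0 c hc)] at hconst
  have := exp_ne_zero (g z)
  field_simp at hconst
  exact hconst.symm

/-- A nonvanishing holomorphic function on `Re s > σ` has a holomorphic logarithm there: the Cayley
transform reduces this to the unit disc. -/
lemma exists_exp_eq_on_halfPlane {f : ℂ → ℂ} {σ : ℝ} (hf : ∀ s : ℂ, σ < s.re → DifferentiableAt ℂ f s)
    (h0 : ∀ s : ℂ, σ < s.re → f s ≠ 0) :
    ∃ g : ℂ → ℂ, (∀ s : ℂ, σ < s.re → DifferentiableAt ℂ g s) ∧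
      ∀ s : ℂ, σ < s.re → exp (g s) = f s := by
  have h1w : ∀ w ∈ Metric.ball (0:ℂ) 1, 1 - w ≠ 0 := fun w hw h => by
    rw [mem_ball_zero_iff, ← sub_eq_zero.1 h] at hw; simp at hw
  have hre : ∀ w ∈ Metric.ball (0:ℂ) 1, σ < (σ + (1 + w) / (1 - w) : ℂ).re := fun w hw => by
    have hn : 0 < normSq (1 - w) := normSq_pos.2 (h1w w hw)
    have h2 : w.re * w.re + w.im * w.im < 1 := by
      rw [mem_ball_zero_iff] at hw
      have : ‖w‖ ^ 2 < 1 := by nlinarith [norm_nonneg w]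
      rwa [Complex.sq_norm, normSq_apply] at this
    rw [add_re, ofReal_re, div_re]
    simp only [add_re, one_re, sub_re, add_im, one_im, sub_im]
    rw [← add_div]
    have : 0 < ((1 + w.re) * (1 - w.re) + (0 + w.im) * (0 - w.im)) / normSq (1 - w) :=
      div_pos (by nlinarith) hn
    linarith
  obtain ⟨G, hGd, hG⟩ := exists_exp_eq_on_ball (f := fun w => f (σ + (1 + w) / (1 - w))) (c := 0)
    (r := 1) (fun w hw => by
      refine DifferentiableAt.differentiableWithinAt ?_
      refine DifferentiableAt.comp w (hf _ (hre w hw)) ?_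
      exact (differentiableAt_const _).add (DifferentiableAt.div (by fun_prop) (by fun_prop) (h1w w hw)))
    (fun w hw => h0 _ (hre w hw))
  have hne : ∀ s : ℂ, σ < s.re → s - σ + 1 ≠ 0 := fun s hs h => by
    have := congrArg Complex.re h; simp at this; linarith
  have hmem : ∀ s : ℂ, σ < s.re → (s - σ - 1) / (s - σ + 1) ∈ Metric.ball (0:ℂ) 1 := fun s hs => by
    rw [mem_ball_zero_iff, norm_div, div_lt_one (norm_pos_iff.2 (hne s hs)),
      ← sq_lt_sq₀ (norm_nonneg _) (norm_nonneg _), Complex.sq_norm, Complex.sq_norm, normSq_apply,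
      normSq_apply]
    simp
    nlinarith
  refine ⟨fun s => G ((s - σ - 1) / (s - σ + 1)), fun s hs => ?_, fun s hs => ?_⟩
  · refine DifferentiableAt.comp s (hGd.differentiableAt (Metric.isOpen_ball.mem_nhds (hmem s hs))) ?_
    exact DifferentiableAt.div (by fun_prop) (by fun_prop) (hne s hs)
  · rw [hG _ (hmem s hs)]
    congr 1
    have h3 := hne s hs
    have h4 : 1 - (s - σ - 1) / (s - σ + 1) ≠ 0 := h1w _ (hmem s hs)
    have : (1 + (s - σ - 1) / (s - σ + 1)) / (1 - (s - σ - 1) / (s - σ + 1)) = s - σ := by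
      rw [div_eq_iff h4]; field_simp; ring
    rw [this]; ring

/-! ### The Dirichlet series over primes -/

section PrimeSeries

lemma norm_neg_log_one_sub_sub_le {z : ℂ} (hz : ‖z‖ ≤ 3 / 4) :
    ‖-log (1 - z) - z‖ ≤ 2 * ‖z‖ ^ 2 := by
  have h := norm_log_one_add_sub_self_le (z := -z) (by rw [norm_neg]; linarith)
  rw [norm_neg] at h
  rw [show -log (1 - z) - z = -(log (1 + -z) - -z) by rw [← sub_eq_add_neg]; ring, norm_neg]
  refine h.trans ?_
  have : (1 - ‖z‖)⁻¹ ≤ 4 := by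
    rw [inv_le_comm₀ (by linarith) (by norm_num)]; linarith
  nlinarith [sq_nonneg ‖z‖]

variable {q : ℕ} (χ : DirichletCharacter ℂ q)

lemma norm_character_mul_cpow_le {p : ℕ} (hp : p.Prime) (s : ℂ) :
    ‖χ p * (p : ℂ) ^ (-s)‖ ≤ (p : ℝ) ^ (-s.re) := by
  rw [norm_mul, norm_natCast_cpow_of_pos hp.pos, neg_re]
  exact mul_le_of_le_one_left (by positivity) (χ.norm_le_one _)

lemma norm_character_mul_cpow_le_three_quarters {p : ℕ} (hp : p.Prime) {s : ℂ}
    (hs : 1 / 2 ≤ s.re) : ‖χ p * (p : ℂ) ^ (-s)‖ ≤ 3 / 4 := by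
  refine (norm_character_mul_cpow_le χ hp s).trans ?_
  have hp2 : (2:ℝ) ≤ p := by exact_mod_cast hp.two_le
  calc (p : ℝ) ^ (-s.re) ≤ (p:ℝ) ^ (-(1 / 2) : ℝ) :=
        Real.rpow_le_rpow_of_exponent_le (by linarith) (by linarith)
    _ ≤ 2 ^ (-(1 / 2) : ℝ) := Real.rpow_le_rpow_of_nonpos (by norm_num) hp2 (by norm_num)
    _ ≤ 3 / 4 := by
      rw [Real.rpow_neg (by norm_num), ← Real.sqrt_eq_rpow, inv_le_comm₀ (by positivity) (by norm_num)]
      apply Real.le_sqrt_of_sq_le; norm_num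

lemma norm_neg_log_one_sub_character_sub_le {p : ℕ} (hp : p.Prime) {s : ℂ} {η : ℝ} (hη : 0 ≤ η)
    (hs : 1 / 2 + η ≤ s.re) :
    ‖-log (1 - χ p * (p : ℂ) ^ (-s)) - χ p * (p : ℂ) ^ (-s)‖ ≤ 2 * (p : ℝ) ^ (-(1 + 2 * η)) := by
  have hp1 : (1:ℝ) ≤ p := by exact_mod_cast hp.one_le
  refine (norm_neg_log_one_sub_sub_le
    (norm_character_mul_cpow_le_three_quarters χ hp (by linarith))).trans ?_
  have h1 : ‖χ p * (p : ℂ) ^ (-s)‖ ≤ (p:ℝ) ^ (-(1 / 2 + η)) :=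
    (norm_character_mul_cpow_le χ hp s).trans (Real.rpow_le_rpow_of_exponent_le hp1 (by linarith))
  have h2 : (p:ℝ) ^ (-(1 + 2 * η)) = ((p:ℝ) ^ (-(1 / 2 + η))) ^ 2 := by
    rw [← Real.rpow_natCast, ← Real.rpow_mul (by positivity)]; congr 1; push_cast; ring
  rw [h2]
  gcongr

/-- The sum `∑ₚ p ^ (-(1 + 2 η))`, which bounds the contribution of proper prime powers. -/
noncomputable def primeSquareSum (η : ℝ) : ℝ := ∑' p : Nat.Primes, (p : ℝ) ^ (-(1 + 2 * η))

lemma summable_primeSquare {η : ℝ} (hη : 0 < η) :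
    Summable fun p : Nat.Primes => (p : ℝ) ^ (-(1 + 2 * η)) :=
  Nat.Primes.summable_rpow.2 (by linarith)

lemma primeSquareSum_nonneg (η : ℝ) : 0 ≤ primeSquareSum η :=
  tsum_nonneg fun p => by positivity

lemma sum_le_primeSquareSum {η : ℝ} (hη : 0 < η) (u : Finset Nat.Primes) :
    ∑ p ∈ u, (p : ℝ) ^ (-(1 + 2 * η)) ≤ primeSquareSum η :=
  (summable_primeSquare hη).sum_le_tsum u fun p _ => by positivity

/-- The contribution of the proper prime powers to `log L(s, χ)`. -/
noncomputable def logRemainder (s : ℂ) : ℂ :=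
  ∑' p : Nat.Primes, (-log (1 - χ (p : ℕ) * ((p : ℕ) : ℂ) ^ (-s)) - χ (p : ℕ) * ((p : ℕ) : ℂ) ^ (-s))

lemma norm_logRemainder_le {η : ℝ} (hη : 0 < η) {s : ℂ} (hs : 1 / 2 + η ≤ s.re) :
    ‖logRemainder χ s‖ ≤ 2 * primeSquareSum η := by
  refine tsum_of_norm_bounded ((summable_primeSquare hη).hasSum.mul_left 2) fun p => ?_
  exact norm_neg_log_one_sub_character_sub_le χ p.2 hη.le hs

lemma differentiableAt_logRemainder {s : ℂ} (hs : 1 / 2 < s.re) :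
    DifferentiableAt ℂ (logRemainder χ) s := by
  obtain ⟨η, hη, hηs⟩ : ∃ η > 0, 1 / 2 + η < s.re := ⟨(s.re - 1 / 2) / 2, by linarith, by linarith⟩
  have hopen : IsOpen {s : ℂ | 1 / 2 + η < s.re} := isOpen_lt continuous_const continuous_re
  refine (differentiableOn_tsum_of_summable_norm ((summable_primeSquare hη).mul_left 2)
    (fun p w hw => ?_) hopen (fun p w hw => ?_)).differentiableAt (hopen.mem_nhds hηs)
  · have hw' : 1 / 2 + η < w.re := hw
    have hd : DifferentiableAt ℂ (fun w : ℂ => χ (p : ℕ) * ((p : ℕ) : ℂ) ^ (-w)) w :=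
      DifferentiableAt.const_mul (DifferentiableAt.const_cpow differentiableAt_id.neg
        (Or.inl (by exact_mod_cast p.2.ne_zero))) _
    refine DifferentiableAt.differentiableWithinAt (DifferentiableAt.sub (DifferentiableAt.neg ?_) hd)
    refine DifferentiableAt.clog (hd.const_sub 1) ?_
    have h34 := norm_character_mul_cpow_le_three_quarters χ p.2 (s := w) (by linarith)
    refine mem_slitPlane_of_norm_lt_one (z := -(χ (p : ℕ) * ((p : ℕ) : ℂ) ^ (-w))) ?_
    rw [norm_neg]; linarith
  · have hw' : 1 / 2 + η < w.re := hw
    exact norm_neg_log_one_sub_character_sub_le χ p.2 hη.le hw'.le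

open Classical in
/-- The coefficients of the Dirichlet series `∑ₚ χ(p) p ^ (-s)`. -/
noncomputable def primeCoeff (n : ℕ) : ℂ := if n.Prime then χ n else 0

lemma norm_primeCoeff_le (n : ℕ) : ‖primeCoeff χ n‖ ≤ 1 := by
  unfold primeCoeff; split_ifs
  · exact χ.norm_le_one _
  · simp

lemma LSeriesSummable_of_norm_le_one {a : ℕ → ℂ} (ha : ∀ n, ‖a n‖ ≤ 1) {s : ℂ} (hs : 1 < s.re) :
    LSeriesSummable a s :=
  LSeriesSummable_of_bounded_of_one_lt_re (fun n _ => ha n) hs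

lemma tsum_primes_eq_LSeries {s : ℂ} :
    ∑' p : Nat.Primes, χ (p : ℕ) * ((p : ℕ) : ℂ) ^ (-s) = LSeries (primeCoeff χ) s := by
  rw [LSeries]
  have h := tsum_subtype {p : ℕ | p.Prime} fun n : ℕ => χ n * (n : ℂ) ^ (-s)
  refine Eq.trans h (tsum_congr fun n => ?_)
  by_cases hn : n.Prime
  · rw [indicator_of_mem (s := {p : ℕ | p.Prime}) hn, LSeries.term_of_ne_zero hn.ne_zero, primeCoeff, if_pos hn, cpow_neg]
    rfl
  · rw [indicator_of_notMem (s := {p : ℕ | p.Prime}) hn]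
    rcases eq_or_ne n 0 with rfl | h0
    · simp
    · rw [LSeries.term_of_ne_zero h0, primeCoeff, if_neg hn, zero_div]

lemma tsum_neg_log_eq {s : ℂ} (hs : 1 < s.re) :
    ∑' p : Nat.Primes, -log (1 - χ (p : ℕ) * ((p : ℕ) : ℂ) ^ (-s)) =
      logRemainder χ s + LSeries (primeCoeff χ) s := by
  rw [← tsum_primes_eq_LSeries, logRemainder, ← Summable.tsum_add]
  · exact tsum_congr fun p => by ring
  · exact Summable.of_norm_bounded ((summable_primeSquare (η := 1 / 2) (by norm_num)).mul_left 2)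
      fun p => norm_neg_log_one_sub_character_sub_le χ p.2 (by norm_num) (by linarith)
  · exact Summable.of_norm_bounded (Nat.Primes.summable_rpow.2 (by linarith : -s.re < -1))
      fun p => norm_character_mul_cpow_le χ p.2 s

variable {χ} in
/-- Under GRH, `log L(s, χ)` minus the contribution of proper prime powers continues the Dirichlet
series over primes to `Re s > 1/2`. -/
lemma exists_continuation_primeSeries [NeZero q] (hGRH : GRH) (hχ : χ ≠ 1) :
    ∃ P : ℂ → ℂ, (∀ s : ℂ, 1 / 2 < s.re → DifferentiableAt ℂ P s) ∧
      (∀ s : ℂ, 1 < s.re → P s = LSeries (primeCoeff χ) s) ∧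
      ∀ s : ℂ, 1 / 2 < s.re → exp (P s + logRemainder χ s) = χ.LFunction s := by
  obtain ⟨F, hFd, hF⟩ := exists_exp_eq_on_halfPlane (f := χ.LFunction) (σ := 1 / 2)
    (fun s _ => (DirichletCharacter.differentiable_LFunction hχ) s)
    (fun s hs => LFunction_ne_zero_of_GRH hGRH hχ hs)
  have hopen : IsOpen {s : ℂ | 1 < s.re} := isOpen_lt continuous_const continuous_re
  -- the two logarithms of `L(s, χ)` on `Re s > 1` differ by a constant
  set E : ℂ → ℂ := fun s => F s - logRemainder χ s - LSeries (primeCoeff χ) s with hE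
  have hEd : ∀ s : ℂ, 1 < s.re → DifferentiableAt ℂ E s := fun s hs => by
    refine ((hFd s (by linarith)).sub (differentiableAt_logRemainder χ (by linarith))).sub ?_
    refine (LSeries_hasDerivAt ?_).differentiableAt
    refine lt_of_le_of_lt (LSeries.abscissaOfAbsConv_le_of_forall_lt_LSeriesSummable' (x := 1) ?_)
      (by exact_mod_cast hs)
    intro y hy
    exact LSeriesSummable_of_norm_le_one (norm_primeCoeff_le χ) (by exact_mod_cast hy)
  have hE1 : ∀ s : ℂ, 1 < s.re → exp (E s) = 1 := fun s hs => by
    have h1 := hF s (by linarith)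
    have h2 := χ.LSeries_eulerProduct_exp_log hs
    rw [tsum_neg_log_eq χ hs, ← DirichletCharacter.LFunction_eq_LSeries χ hs] at h2
    rw [hE]
    simp only
    rw [sub_sub, exp_sub, h1, h2, div_self]
    exact LFunction_ne_zero_of_GRH hGRH hχ (by linarith)
  have hE2 : ∀ s : ℂ, 1 < s.re → E s = E 2 := fun s hs => by
    refine hopen.is_const_of_deriv_eq_zero (convex_halfSpace_re_gt 1).isPreconnected
      (fun s hs => (hEd s hs).differentiableWithinAt) (fun s hs => ?_) hs (by simp)
    have h1 : HasDerivAt (fun s => exp (E s)) (exp (E s) * deriv E s) s := (hEd s hs).hasDerivAt.cexp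
    have h2 : (fun s => exp (E s)) =ᶠ[𝓝 s] fun _ => 1 := by
      filter_upwards [hopen.mem_nhds hs] with z hz using hE1 z hz
    have h3 := (h1.congr_of_eventuallyEq h2.symm).unique (hasDerivAt_const s (1:ℂ))
    exact (mul_eq_zero.1 h3).resolve_left (exp_ne_zero _)
  refine ⟨fun s => F s - logRemainder χ s - E 2, fun s hs => ?_, fun s hs => ?_, fun s hs => ?_⟩
  · exact ((hFd s hs).sub (differentiableAt_logRemainder χ hs)).sub_const _
  · simp only
    rw [← hE2 s hs, hE]; ring
  · rw [show F s - logRemainder χ s - E 2 + logRemainder χ s = F s - E 2 by ring, exp_sub,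
      hE1 2 (by simp), div_one, hF s hs]

/-- The analytic conductor `q (|t| + 2)`. -/
noncomputable def conductor (q : ℕ) (t : ℝ) : ℝ := q * (|t| + 2)

lemma four_le_conductor {q : ℕ} (hq : 1 < q) (t : ℝ) : 4 ≤ conductor q t := by
  have : (2:ℝ) ≤ q := by exact_mod_cast hq
  unfold conductor
  nlinarith [abs_nonneg t]

lemma one_le_log_conductor {q : ℕ} (hq : 1 < q) (t : ℝ) : 1 ≤ Real.log (conductor q t) := by
  rw [Real.le_log_iff_exp_le (by linarith [four_le_conductor hq t])]
  linarith [four_le_conductor hq t, Real.exp_one_lt_d9]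

/-- Under GRH, the continued Dirichlet series over primes is `O(log (q (|t| + 2)))` on
`1/2 + η ≤ Re s ≤ 2`, by the Borel–Carathéodory theorem on discs centred on `Re s = 2`. -/
lemma exists_continuation_primeSeries_bound (hGRH : GRH) {η : ℝ} (hη : 0 < η) (hη1 : η ≤ 1) :
    ∃ C : ℝ, 0 < C ∧ ∀ q : ℕ, 1 < q → ∀ χ : DirichletCharacter ℂ q, χ ≠ 1 →
      ∃ P : ℂ → ℂ, (∀ s : ℂ, 1 / 2 < s.re → DifferentiableAt ℂ P s) ∧
      (∀ s : ℂ, 1 < s.re → P s = LSeries (primeCoeff χ) s) ∧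
      ∀ s : ℂ, 1 / 2 + η ≤ s.re → s.re ≤ 2 → ‖P s‖ ≤ C * Real.log (conductor q s.im) := by
  have hsum2 : Summable fun n : ℕ => 1 / (n:ℝ) ^ 2 := Real.summable_one_div_nat_pow.2 (by norm_num)
  set Z : ℝ := ∑' n : ℕ, 1 / (n:ℝ) ^ 2 with hZ
  have hZ0 : 0 ≤ Z := tsum_nonneg fun n => by positivity
  set B := 2 * primeSquareSum η with hB
  have hB0 : 0 ≤ B := by have := primeSquareSum_nonneg η; positivity
  refine ⟨12 / η + 6 * (Z + B) / η + B, by positivity, fun q hq χ hχ => ?_⟩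
  have : NeZero q := ⟨by omega⟩
  obtain ⟨P, hPd, hPL, hPexp⟩ := exists_continuation_primeSeries hGRH hχ
  refine ⟨P, hPd, hPL, fun s hs hs2 => ?_⟩
  set t := s.im with ht
  set l := Real.log (conductor q t) with hl
  have hl1 : 1 ≤ l := one_le_log_conductor hq t
  have hQ := four_le_conductor hq t
  -- disc centred at `2 + i t`: radius `3/2 - η/2` stays in `Re > 1/2`, and `s` is at distance at most
  -- `3/2 - η` from the centre
  set c : ℂ := 2 + t * I with hc
  set F : ℂ → ℂ := fun z => P (c + z) + logRemainder χ (c + z) with hF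
  set R : ℝ := 3 / 2 - η / 2 with hR
  have hcre : c.re = 2 := by simp [hc]
  have hcim : c.im = t := by simp [hc]
  have hball : ∀ z ∈ Metric.ball (0:ℂ) R, 1 / 2 < (c + z).re := fun z hz => by
    rw [mem_ball_zero_iff] at hz
    have := (abs_le.1 (abs_re_le_norm z)).1
    rw [add_re, hcre]; linarith
  have hFd : DifferentiableOn ℂ F (Metric.ball 0 R) := fun z hz => by
    have h1 : DifferentiableAt ℂ (fun z => c + z) z := by fun_prop
    have h2 := hball z hz
    exact ((DifferentiableAt.comp z (hPd _ h2) h1).add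
      (DifferentiableAt.comp z (differentiableAt_logRemainder χ h2) h1)).differentiableWithinAt
  have hFre : MapsTo F (Metric.ball 0 R) {z | z.re ≤ 2 * l} := fun z hz => by
    have h2 := hball z hz
    have hzn : ‖z‖ < 3 / 2 := by rw [mem_ball_zero_iff] at hz; linarith
    have h3 := hPexp _ h2
    have h4 := norm_LFunction_le hq hχ h2.le
    rw [← h3, norm_exp] at h4
    have hn : ‖c + z‖ ≤ |t| + 4 := by
      have : ‖c‖ ≤ 2 + |t| := by
        refine (norm_add_le _ _).trans ?_
        rw [norm_mul, norm_I, norm_real, mul_one, Real.norm_eq_abs]; norm_num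
      linarith [norm_add_le c z]
    have h5 : Real.exp (F z).re ≤ conductor q t ^ 2 := by
      refine h4.trans ?_
      have : 2 * (q:ℝ) * ‖c + z‖ ≤ 4 * conductor q t := by
        unfold conductor
        nlinarith [abs_nonneg t, Nat.cast_nonneg (α := ℝ) q,
          mul_nonneg (Nat.cast_nonneg (α := ℝ) q) (abs_nonneg t),
          mul_le_mul_of_nonneg_left hn (Nat.cast_nonneg (α := ℝ) q)]
      nlinarith
    show (F z).re ≤ 2 * l
    rw [hl, ← Real.log_rpow (by linarith), Real.le_log_iff_exp_le (by positivity)]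
    exact_mod_cast h5
  have hF0 : ‖F 0‖ ≤ Z + B := by
    simp only [hF, add_zero]
    rw [hPL c (by rw [hcre]; norm_num)]
    refine (norm_add_le _ _).trans (add_le_add ?_ (norm_logRemainder_le χ hη (by rw [hcre]; linarith)))
    exact tsum_of_norm_bounded hsum2.hasSum fun n =>
      norm_LSeries_term_two_le (norm_primeCoeff_le χ) hcre n
  have hzc : s - c = ((s.re - 2 : ℝ) : ℂ) := by
    apply Complex.ext <;> simp [hcre, hcim, ht]
  have hzn : ‖s - c‖ = 2 - s.re := by
    rw [hzc, norm_real, Real.norm_eq_abs, abs_of_nonpos (by linarith)]; ring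
  have hmain := borelCaratheodory (by linarith : 0 < 2 * l) hFd hFre (by linarith)
    (z := s - c) (by rw [mem_ball_zero_iff, hzn]; linarith)
  have hFs : F (s - c) = P s + logRemainder χ s := by simp only [hF]; rw [add_sub_cancel]
  rw [hFs, hzn] at hmain
  have hden : η / 2 ≤ R - (2 - s.re) := by linarith
  have hd1 : 2 * (2 * l) * (2 - s.re) / (R - (2 - s.re)) ≤ 12 / η * l := by
    calc 2 * (2 * l) * (2 - s.re) / (R - (2 - s.re)) ≤ 2 * (2 * l) * (3 / 2) / (η / 2) := by
          gcongr; linarith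
      _ = 12 / η * l := by field_simp; ring
  have hd2 : ‖F 0‖ * (R + (2 - s.re)) / (R - (2 - s.re)) ≤ 6 * (Z + B) / η * l := by
    calc ‖F 0‖ * (R + (2 - s.re)) / (R - (2 - s.re)) ≤ (Z + B) * 3 / (η / 2) := by
          gcongr <;> linarith
      _ = 6 * (Z + B) / η * 1 := by field_simp; ring
      _ ≤ _ := by gcongr
  have hrem := norm_logRemainder_le χ hη hs
  have hBl : B ≤ B * l := le_mul_of_one_le_right hB0 hl1
  calc ‖P s‖ = ‖(P s + logRemainder χ s) - logRemainder χ s‖ := by rw [add_sub_cancel_right]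
    _ ≤ ‖P s + logRemainder χ s‖ + ‖logRemainder χ s‖ := norm_sub_le _ _
    _ ≤ (12 / η * l + 6 * (Z + B) / η * l) + B * l := by linarith
    _ = _ := by ring

end PrimeSeries

/-! ### Prime sums and truncated Euler products under GRH -/

lemma one_add_log_le {η v : ℝ} (hη : 0 < η) (hv : 1 ≤ v) :
    1 + Real.log v ≤ (1 + 1 / η) * v ^ η := by
  have h1 := Real.log_le_rpow_div (by linarith : 0 ≤ v) hη
  have h2 : 1 ≤ v ^ η := Real.one_le_rpow hv hη.le
  calc 1 + Real.log v ≤ v ^ η + v ^ η / η := by linarith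
    _ = _ := by ring

lemma LSeries_twist {c : ℕ → ℂ} (t : ℝ) (s : ℂ) :
    LSeries (fun n => c n * (n : ℂ) ^ (-(t * I))) s = LSeries c (s + t * I) := by
  refine tsum_congr fun n => ?_
  rcases eq_or_ne n 0 with rfl | hn
  · simp
  · have hn' : (n : ℂ) ≠ 0 := by exact_mod_cast hn
    rw [LSeries.term_of_ne_zero hn, LSeries.term_of_ne_zero hn, cpow_add _ _ hn', cpow_neg]
    rw [div_eq_mul_inv, div_eq_mul_inv, mul_inv]
    ring

lemma conductor_le {q : ℕ} {t u T : ℝ} (h : |u| ≤ |t| + T) (hT : 0 ≤ T) :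
    conductor q u ≤ conductor q t * (1 + T) := by
  unfold conductor
  rw [mul_assoc]
  gcongr
  nlinarith [abs_nonneg t]

/-- Under GRH, the twisted character sum over primes up to `v` is
`O(v ^ (1/2 + 2η) log (q (|t| + 2)))`. -/
lemma exists_norm_sum_primeCoeff_le (hGRH : GRH) {η : ℝ} (hη : 0 < η) (hη1 : η ≤ 1 / 2) :
    ∃ C : ℝ, 0 < C ∧ ∀ q : ℕ, 1 < q → ∀ χ : DirichletCharacter ℂ q, χ ≠ 1 → ∀ t v : ℝ, 1 ≤ v →
      ‖∑ n ∈ Finset.Icc 1 ⌊v⌋₊, primeCoeff χ n * (n : ℂ) ^ (-(t * I))‖ ≤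
        C * v ^ (1 / 2 + 2 * η) * Real.log (conductor q t) := by
  obtain ⟨K, hK, hPerron⟩ := exists_norm_sum_le_of_continuation
  obtain ⟨C₁, hC₁, hP⟩ := exists_continuation_primeSeries_bound hGRH hη (by linarith)
  set D := 1 + 1 / (η / 2) with hD
  have hD0 : 0 < D := by positivity
  refine ⟨K * (1 + 3 * C₁ * D ^ 2), by positivity, fun q hq χ hχ t v hv => ?_⟩
  obtain ⟨P, hPd, hPL, hPb⟩ := hP q hq χ hχ
  set l := Real.log (conductor q t) with hl
  have hl1 : 1 ≤ l := one_le_log_conductor hq t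
  have hQ := four_le_conductor hq t
  have hv0 : 0 < v := by linarith
  have hlv : 0 ≤ Real.log v := Real.log_nonneg hv
  have hmain := hPerron (fun n => primeCoeff χ n * (n : ℂ) ^ (-(t * I))) (fun s => P (s + t * I))
    (1 / 2 + η) v (3 * C₁ * l * (1 + Real.log v)) (fun n => ?_) ?_ (by linarith) (by linarith) hv
    (by positivity) (fun s hs => ?_) (fun s hs _ _ => ?_) (fun s hs hs2 hsi => ?_)
  · refine hmain.trans ?_
    have h1 := one_add_log_le (half_pos hη) hv
    have e1 : (1 + Real.log v) ^ 2 ≤ D ^ 2 * v ^ η := by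
      calc (1 + Real.log v) ^ 2 ≤ (D * v ^ (η / 2)) ^ 2 := by gcongr
        _ = D ^ 2 * v ^ η := by
          rw [mul_pow, ← Real.rpow_natCast (v ^ (η / 2)), ← Real.rpow_mul hv0.le]
          congr 2; push_cast; ring
    have e2 : √v ≤ v ^ (1 / 2 + 2 * η) * l := by
      rw [Real.sqrt_eq_rpow]
      have : v ^ (1 / 2 : ℝ) ≤ v ^ (1 / 2 + 2 * η) :=
        Real.rpow_le_rpow_of_exponent_le hv (by linarith)
      exact this.trans (le_mul_of_one_le_right (by positivity) hl1)
    have e3 : 3 * C₁ * l * (1 + Real.log v) * v ^ (1 / 2 + η) * (1 + Real.log v) ≤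
        3 * C₁ * D ^ 2 * (v ^ (1 / 2 + 2 * η) * l) := by
      calc _ = 3 * C₁ * l * v ^ (1 / 2 + η) * (1 + Real.log v) ^ 2 := by ring
        _ ≤ 3 * C₁ * l * v ^ (1 / 2 + η) * (D ^ 2 * v ^ η) := by gcongr
        _ = 3 * C₁ * D ^ 2 * ((v ^ (1 / 2 + η) * v ^ η) * l) := by ring
        _ = _ := by rw [← Real.rpow_add hv0, show 1 / 2 + η + η = 1 / 2 + 2 * η by ring]
    calc _ ≤ K * (v ^ (1 / 2 + 2 * η) * l + 3 * C₁ * D ^ 2 * (v ^ (1 / 2 + 2 * η) * l)) := by gcongr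
      _ = _ := by ring
  · rcases eq_or_ne n 0 with rfl | hn
    · simp [primeCoeff, Nat.not_prime_zero]
    · rw [norm_mul, norm_natCast_cpow_of_pos (Nat.pos_of_ne_zero hn)]
      simpa using norm_primeCoeff_le χ n
  · simp [primeCoeff, Nat.not_prime_zero]
  · rw [LSeries_twist]
    exact hPL _ (by simp [hs])
  · exact DifferentiableAt.comp s (hPd _ (by simp; linarith)) (by fun_prop)
  · have hre : (s + t * I).re = s.re := by simp
    have him : (s + t * I).im = s.im + t := by simp
    have h1 := hPb (s + t * I) (by rw [hre]; exact hs) (by rw [hre]; exact hs2)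
    refine h1.trans ?_
    rw [him]
    have h2 : conductor q (s.im + t) ≤ conductor q t * (1 + v ^ 3) :=
      conductor_le ((abs_add_le _ _).trans (by linarith)) (by positivity)
    have h3 : Real.log (conductor q (s.im + t)) ≤ l + Real.log (1 + v ^ 3) := by
      rw [hl, ← Real.log_mul (by linarith) (by positivity)]
      exact Real.log_le_log (by linarith [four_le_conductor hq (s.im + t)]) h2
    have h4 : Real.log (1 + v ^ 3) ≤ 1 + 3 * Real.log v := by
      calc Real.log (1 + v ^ 3) ≤ Real.log (2 * v ^ 3) :=
            Real.log_le_log (by positivity) (by linarith [one_le_pow₀ hv (n := 3)])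
        _ = Real.log 2 + 3 * Real.log v := by
          rw [Real.log_mul (by norm_num) (by positivity), Real.log_pow]; norm_num
        _ ≤ _ := by linarith [Real.log_two_lt_d9]
    have h5 : Real.log (conductor q (s.im + t)) ≤ 3 * (l * (1 + Real.log v)) := by nlinarith
    calc C₁ * Real.log (conductor q (s.im + t)) ≤ C₁ * (3 * (l * (1 + Real.log v))) := by gcongr
      _ = _ := by ring

/-- Partial summation: a sequence with summatory function `O(v ^ θ)` has
`∑_{m < n ≤ N} c(n) n ^ (-σ) = O(m ^ (-η))` for `σ ≥ θ + η`. -/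
lemma norm_sum_Ioc_mul_rpow_le {c : ℕ → ℂ} (hc : c 0 = 0) {θ η σ C : ℝ} (hη : 0 < η)
    (hσ : θ + η ≤ σ) (hσ0 : 0 < σ) (hσ2 : σ ≤ 2) (hC : 0 ≤ C)
    (hb : ∀ v : ℝ, 1 ≤ v → ‖∑ n ∈ Finset.Icc 1 ⌊v⌋₊, c n‖ ≤ C * v ^ θ) {m N : ℕ} (hm : 1 ≤ m)
    (hmN : m ≤ N) :
    ‖∑ n ∈ Finset.Ioc m N, ((n : ℝ) : ℂ) ^ (-σ : ℂ) * c n‖ ≤ C * (2 + 2 / η) * (m : ℝ) ^ (-η) := by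
  have hm1 : (1:ℝ) ≤ m := by exact_mod_cast hm
  have hmN' : (m:ℝ) ≤ N := by exact_mod_cast hmN
  have hder : ∀ u : ℝ, 0 < u → HasDerivAt (fun u : ℝ => (u : ℂ) ^ (-σ : ℂ))
      (-σ * (u : ℂ) ^ (-σ - 1 : ℂ)) u := fun u hu =>
    hasDerivAt_ofReal_cpow_const hu.ne' (by
      rw [neg_ne_zero]; exact_mod_cast hσ0.ne')
  have hS : ∀ v : ℝ, 1 ≤ v → ‖∑ n ∈ Finset.Icc 0 ⌊v⌋₊, c n‖ ≤ C * v ^ θ := fun v hv => by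
    rw [← Finset.sum_subset (Finset.Icc_subset_Icc_left zero_le_one) fun n _ hn' => ?_]
    · exact hb v hv
    · have : n = 0 := by simp_all
      rw [this, hc]
  have habel := sum_mul_eq_sub_sub_integral_mul c (f := fun u : ℝ => (u : ℂ) ^ (-σ : ℂ))
    (Nat.cast_nonneg m) hmN' (fun u hu => (hder u (by linarith [hu.1])).differentiableAt) (by
      refine ContinuousOn.integrableOn_Icc ?_
      refine ContinuousOn.congr (f := fun u : ℝ => -σ * (u : ℂ) ^ (-σ - 1 : ℂ)) ?_
        (fun u hu => (hder u (by linarith [hu.1])).deriv)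
      intro u hu
      have hu0 : 0 < u := by linarith [hu.1]
      refine ContinuousAt.continuousWithinAt (continuousAt_const.mul ?_)
      exact (continuousAt_ofReal_cpow_const _ _ (Or.inr hu0.ne')))
  rw [Nat.floor_natCast, Nat.floor_natCast] at habel
  have hend : ∀ u : ℝ, (m:ℝ) ≤ u → ∀ w : ℂ, ‖w‖ ≤ C * u ^ θ → 
      ‖(u : ℂ) ^ (-σ : ℂ) * w‖ ≤ C * u ^ (-η) := fun u hu w hw => by
    have hu0 : 0 < u := by linarith
    rw [norm_mul, norm_cpow_eq_rpow_re_of_pos hu0]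
    calc u ^ (-σ : ℂ).re * ‖w‖ ≤ u ^ (-σ) * (C * u ^ θ) := by
          rw [neg_re, ofReal_re]; gcongr
      _ = C * u ^ (θ - σ) := by
          rw [show θ - σ = -σ + θ by ring, Real.rpow_add hu0]; ring
      _ ≤ C * u ^ (-η) := by
          gcongr
          · linarith
          · linarith
  have hint : ‖∫ u in Ioc (m:ℝ) N, deriv (fun u : ℝ => (u : ℂ) ^ (-σ : ℂ)) u *
      ∑ k ∈ Finset.Icc 0 ⌊u⌋₊, c k‖ ≤ C * (2 / η) * (m : ℝ) ^ (-η) := by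
    have hi : IntegrableOn (fun u : ℝ => 2 * C * u ^ (-η - 1)) (Ioi (m:ℝ)) :=
      (integrableOn_Ioi_rpow_of_lt (by linarith) (by linarith)).const_mul _
    have hi' : IntegrableOn (fun u : ℝ => 2 * C * u ^ (-η - 1)) (Ioc (m:ℝ) N) :=
      hi.mono_set Ioc_subset_Ioi_self
    have h1 := norm_integral_le_of_norm_le hi'
      (f := fun u => deriv (fun u : ℝ => (u : ℂ) ^ (-σ : ℂ)) u * ∑ k ∈ Finset.Icc 0 ⌊u⌋₊, c k) <|
      (ae_restrict_iff' measurableSet_Ioc).2 <| Eventually.of_forall fun u hu => by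
        have hu1 : 1 ≤ u := by linarith [hu.1]
        have hu0 : 0 < u := by linarith
        rw [(hder u hu0).deriv, cpow_sub _ _ (by exact_mod_cast hu0.ne'), cpow_one,
          show ∀ w : ℂ, -(σ : ℂ) * ((u : ℂ) ^ (-σ : ℂ) / u) * w =
            (-(σ : ℂ) / u) * ((u : ℂ) ^ (-σ : ℂ) * w) from fun w => by ring, norm_mul, norm_div,
          norm_neg, norm_real, norm_real, Real.norm_of_nonneg hσ0.le, Real.norm_of_nonneg hu0.le]
        calc _ ≤ 2 / u * (C * u ^ (-η)) := by
              gcongr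
              exact hend u hu.1.le _ (hS u hu1)
          _ = 2 * C * u ^ (-η - 1) := by rw [Real.rpow_sub hu0, Real.rpow_one]; ring
    refine h1.trans ((setIntegral_mono_set hi ?_ Ioc_subset_Ioi_self.eventuallyLE).trans
      (le_of_eq ?_))
    · exact (ae_restrict_iff' measurableSet_Ioi).2 <| Eventually.of_forall fun u hu => by
        have hu' : (m:ℝ) < u := hu
        have : 0 ≤ u := by linarith
        simp only [Pi.zero_apply]
        positivity
    · rw [integral_const_mul, integral_Ioi_rpow_of_lt (by linarith) (by linarith),
        show -η - 1 + 1 = -η by ring]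
      field_simp
  have hSm : ∀ n : ℕ, 1 ≤ n → ‖∑ k ∈ Finset.Icc 0 n, c k‖ ≤ C * (n:ℝ) ^ θ := fun n hn => by
    have := hS n (by exact_mod_cast hn)
    rwa [Nat.floor_natCast] at this
  have hN := hend N hmN' _ (hSm N (by omega))
  have hM := hend m le_rfl _ (hSm m hm)
  have hNM : C * (N:ℝ) ^ (-η) ≤ C * (m:ℝ) ^ (-η) := by
    gcongr ?_ * ?_
    exact Real.rpow_le_rpow_of_nonpos (by linarith) hmN' (by linarith)
  rw [habel]
  refine (norm_sub_le _ _).trans ((add_le_add (norm_sub_le _ _) hint).trans ?_)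
  calc _ ≤ C * (m:ℝ) ^ (-η) + C * (m:ℝ) ^ (-η) + C * (2 / η) * (m : ℝ) ^ (-η) := by
        gcongr
        exact hN.trans hNM
    _ = _ := by ring

/-- Under GRH, the Dirichlet polynomial over primes up to `N` is at most
`δ log (q (|t| + 2)) + O(1)`, uniformly in `N`, on `1/2 + 3η ≤ Re s ≤ 2`: primes up to a constant are
bounded trivially, and a large constant makes the tail small. -/
lemma exists_norm_sum_primeCoeff_cpow_le (hGRH : GRH) {η δ : ℝ} (hη : 0 < η) (hη1 : η ≤ 1 / 2)
    (hδ : 0 < δ) :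
    ∃ C : ℝ, 0 ≤ C ∧ ∀ q : ℕ, 1 < q → ∀ χ : DirichletCharacter ℂ q, χ ≠ 1 → ∀ s : ℂ,
      1 / 2 + 3 * η ≤ s.re → s.re ≤ 2 → ∀ N : ℕ,
      ‖∑ n ∈ Finset.Icc 1 N, primeCoeff χ n * (n : ℂ) ^ (-s)‖ ≤
        C + δ * Real.log (conductor q s.im) := by
  obtain ⟨C, hC, hsum⟩ := exists_norm_sum_primeCoeff_le hGRH hη hη1
  have hlim : Tendsto (fun m : ℕ => C * (2 + 2 / η) * (m:ℝ) ^ (-η)) atTop (𝓝 0) := by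
    have := ((tendsto_rpow_neg_atTop hη).comp tendsto_natCast_atTop_atTop).const_mul
      (C * (2 + 2 / η))
    simpa using this
  obtain ⟨m, hmδ, hm⟩ := ((hlim.eventually_lt_const hδ).and (eventually_ge_atTop 1)).exists
  refine ⟨m, Nat.cast_nonneg m, fun q hq χ hχ s hs hs2 N => ?_⟩
  set l := Real.log (conductor q s.im) with hl
  have hl1 : 1 ≤ l := one_le_log_conductor hq s.im
  have htriv : ∀ M : ℕ, ‖∑ n ∈ Finset.Icc 1 M, primeCoeff χ n * (n : ℂ) ^ (-s)‖ ≤ M := fun M => by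
    refine (norm_sum_le_of_le (f := fun n => primeCoeff χ n * (n : ℂ) ^ (-s)) (n := fun _ => (1:ℝ))
      _ fun n hn => ?_).trans (by simp)
    have hn1 : 1 ≤ n := (Finset.mem_Icc.1 hn).1
    rw [norm_mul, norm_natCast_cpow_of_pos hn1]
    refine mul_le_one₀ (norm_primeCoeff_le χ n) (by positivity) ?_
    exact Real.rpow_le_one_of_one_le_of_nonpos (by exact_mod_cast hn1) (by simp; linarith)
  rcases le_or_gt N m with hN | hN
  · have : (N:ℝ) ≤ m := by exact_mod_cast hN
    have : 0 ≤ δ * l := by positivity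
    linarith [htriv N]
  · have hsplit : ∑ n ∈ Finset.Icc 1 N, primeCoeff χ n * (n : ℂ) ^ (-s) =
        ∑ n ∈ Finset.Icc 1 m, primeCoeff χ n * (n : ℂ) ^ (-s) +
        ∑ n ∈ Finset.Ioc m N, primeCoeff χ n * (n : ℂ) ^ (-s) := by
      rw [← Finset.sum_union]
      · congr 1; ext n; simp only [Finset.mem_Icc, Finset.mem_Ioc, Finset.mem_union]; omega
      · rw [Finset.disjoint_left]; intro n; simp only [Finset.mem_Icc, Finset.mem_Ioc]; omega
    rw [hsplit]
    have htail := norm_sum_Ioc_mul_rpow_le (c := fun n => primeCoeff χ n * (n : ℂ) ^ (-(s.im * I)))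
      (θ := 1 / 2 + 2 * η) (σ := s.re) (C := C * l) (by simp [primeCoeff, Nat.not_prime_zero]) hη
      (by linarith) (by linarith) hs2 (by positivity)
      (fun v hv => (hsum q hq χ hχ s.im v hv).trans (le_of_eq (by ring))) hm hN.le
    have hterm : ∑ n ∈ Finset.Ioc m N, ((n : ℝ) : ℂ) ^ (-s.re : ℂ) *
        (primeCoeff χ n * (n : ℂ) ^ (-(s.im * I))) =
        ∑ n ∈ Finset.Ioc m N, primeCoeff χ n * (n : ℂ) ^ (-s) := by
      refine Finset.sum_congr rfl fun n hn => ?_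
      have hn0 : (n : ℂ) ≠ 0 := by
        have := (Finset.mem_Ioc.1 hn).1
        exact_mod_cast (by omega : n ≠ 0)
      have hs' : -s = -(s.re : ℂ) + -(s.im * I) := by
        conv_lhs => rw [← re_add_im s]
        ring
      rw [hs', cpow_add _ _ hn0, ofReal_natCast]; ring
    rw [hterm] at htail
    have hfin : C * l * (2 + 2 / η) * (m:ℝ) ^ (-η) ≤ δ * l := by
      calc _ = (C * (2 + 2 / η) * (m:ℝ) ^ (-η)) * l := by ring
        _ ≤ _ := by gcongr
    exact (norm_add_le _ _).trans (add_le_add (htriv m) (htail.trans hfin))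

/-- Under GRH, truncated Euler products are `O((q (|t| + 2)) ^ δ)` on `1/2 + 3η ≤ Re s ≤ 2`,
uniformly in the truncation. -/
lemma exists_norm_eulerProduct_le (hGRH : GRH) {η δ : ℝ} (hη : 0 < η) (hη1 : η ≤ 1 / 2)
    (hδ : 0 < δ) :
    ∃ C : ℝ, 0 < C ∧ ∀ q : ℕ, 1 < q → ∀ χ : DirichletCharacter ℂ q, χ ≠ 1 → ∀ s : ℂ,
      1 / 2 + 3 * η ≤ s.re → s.re ≤ 2 → ∀ N : ℕ,
      ‖∏ p ∈ Nat.primesBelow (N + 1), (1 - χ p * (p : ℂ) ^ (-s))⁻¹‖ ≤ C * conductor q s.im ^ δ := by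
  obtain ⟨C, hC, hsum⟩ := exists_norm_sum_primeCoeff_cpow_le hGRH hη hη1 hδ
  set B := 2 * primeSquareSum η with hB
  refine ⟨Real.exp (C + B), Real.exp_pos _, fun q hq χ hχ s hs hs2 N => ?_⟩
  have hQ := four_le_conductor hq s.im
  have hexp : ∏ p ∈ Nat.primesBelow (N + 1), (1 - χ p * (p : ℂ) ^ (-s))⁻¹ =
      exp (∑ p ∈ Nat.primesBelow (N + 1), -log (1 - χ p * (p : ℂ) ^ (-s))) := by
    rw [exp_sum]
    refine Finset.prod_congr rfl fun p hp => ?_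
    have h34 := norm_character_mul_cpow_le_three_quarters χ (Nat.prime_of_mem_primesBelow hp)
      (s := s) (by linarith)
    rw [exp_neg, exp_log]
    intro h0
    rw [← sub_eq_zero.1 h0, norm_one] at h34
    norm_num at h34
  have hsplit : ∑ p ∈ Nat.primesBelow (N + 1), -log (1 - χ p * (p : ℂ) ^ (-s)) =
      ∑ n ∈ Finset.Icc 1 N, primeCoeff χ n * (n : ℂ) ^ (-s) +
      ∑ p ∈ Nat.primesBelow (N + 1), (-log (1 - χ p * (p : ℂ) ^ (-s)) - χ p * (p : ℂ) ^ (-s)) := by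
    have : ∑ n ∈ Finset.Icc 1 N, primeCoeff χ n * (n : ℂ) ^ (-s) =
        ∑ p ∈ Nat.primesBelow (N + 1), χ p * (p : ℂ) ^ (-s) := by
      symm
      refine Eq.trans (Finset.sum_congr rfl fun p hp => ?_) (Finset.sum_subset (fun p hp => ?_)
        fun n hn hn' => ?_)
      · rw [primeCoeff, if_pos (Nat.prime_of_mem_primesBelow hp)]
      · have := Nat.lt_of_mem_primesBelow hp
        exact Finset.mem_Icc.2 ⟨(Nat.prime_of_mem_primesBelow hp).one_le, by omega⟩
      · have hnp : ¬ n.Prime := fun h => hn' (Nat.mem_primesBelow.2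
          ⟨by have := (Finset.mem_Icc.1 hn).2; omega, h⟩)
        rw [primeCoeff, if_neg hnp, zero_mul]
    rw [this, ← Finset.sum_add_distrib]
    exact Finset.sum_congr rfl fun p _ => by ring
  have hrem : ‖∑ p ∈ Nat.primesBelow (N + 1),
      (-log (1 - χ p * (p : ℂ) ^ (-s)) - χ p * (p : ℂ) ^ (-s))‖ ≤ B := by
    refine (norm_sum_le_of_le _ fun p hp => norm_neg_log_one_sub_character_sub_le χ
      (Nat.prime_of_mem_primesBelow hp) hη.le (by linarith : 1 / 2 + η ≤ s.re)).trans ?_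
    rw [← Finset.mul_sum, hB]
    refine mul_le_mul_of_nonneg_left ?_ (by norm_num)
    rw [← Finset.sum_subtype_of_mem (p := Nat.Prime) (fun p : ℕ => (p:ℝ) ^ (-(1 + 2 * η)))
      fun p hp => Nat.prime_of_mem_primesBelow hp]
    exact sum_le_primeSquareSum hη _
  rw [hexp, norm_exp, hsplit]
  calc _ ≤ Real.exp ((C + δ * Real.log (conductor q s.im)) + B) := by
        refine Real.exp_le_exp.2 ((re_le_norm _).trans ((norm_add_le _ _).trans ?_))
        exact add_le_add (hsum q hq χ hχ s hs hs2 N) hrem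
    _ = Real.exp (C + B) * conductor q s.im ^ δ := by
        rw [Real.rpow_def_of_pos (by linarith), ← Real.exp_add]; congr 1; ring

/-! ### Character sums over smooth numbers -/

open Classical in
/-- `χ` restricted to the integers all of whose prime factors are at most `N`. -/
noncomputable def smoothCoeff {q : ℕ} (χ : DirichletCharacter ℂ q) (N n : ℕ) : ℂ :=
  if n ∈ Nat.smoothNumbers (N + 1) then χ n else 0

lemma norm_smoothCoeff_le {q : ℕ} (χ : DirichletCharacter ℂ q) (N n : ℕ) :
    ‖smoothCoeff χ N n‖ ≤ 1 := by
  unfold smoothCoeff; split_ifs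
  · exact χ.norm_le_one _
  · simp

lemma smoothCoeff_zero {q : ℕ} (χ : DirichletCharacter ℂ q) (N : ℕ) : smoothCoeff χ N 0 = 0 := by
  rw [smoothCoeff, if_neg]
  exact fun h => Nat.ne_zero_of_mem_smoothNumbers h rfl

lemma LSeries_smoothCoeff {q : ℕ} (χ : DirichletCharacter ℂ q) (N : ℕ) {s : ℂ} (hs : 1 < s.re) :
    LSeries (smoothCoeff χ N) s =
      ∏ p ∈ Nat.primesBelow (N + 1), (1 - χ p * (p : ℂ) ^ (-s))⁻¹ := by
  have h := EulerProduct.prod_primesBelow_geometric_eq_tsum_smoothNumbers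
    (f := (dirichletSummandHom χ (ne_zero_of_one_lt_re hs) : ℕ →* ℂ))
    (summable_dirichletSummand χ hs).of_norm (N + 1)
  refine Eq.trans ?_ h.symm
  rw [LSeries]
  refine Eq.trans (tsum_congr fun n => ?_) (tsum_subtype (Nat.smoothNumbers (N + 1)) fun n : ℕ =>
    χ n * (n : ℂ) ^ (-s)).symm
  by_cases hn : n ∈ Nat.smoothNumbers (N + 1)
  · rw [indicator_of_mem hn, LSeries.term_of_ne_zero (Nat.ne_zero_of_mem_smoothNumbers hn),
      smoothCoeff, if_pos hn, cpow_neg]; rfl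
  · rw [indicator_of_notMem hn]
    rcases eq_or_ne n 0 with rfl | h0
    · simp
    · rw [LSeries.term_of_ne_zero h0, smoothCoeff, if_neg hn, zero_div]

lemma differentiableAt_eulerProduct {q : ℕ} (χ : DirichletCharacter ℂ q) (N : ℕ) {s : ℂ}
    (hs : 1 / 2 ≤ s.re) :
    DifferentiableAt ℂ
      (fun s => ∏ p ∈ Nat.primesBelow (N + 1), (1 - χ p * (p : ℂ) ^ (-s))⁻¹) s := by
  refine DifferentiableAt.fun_finsetProd fun p hp => ?_
  have hpp := Nat.prime_of_mem_primesBelow hp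
  refine DifferentiableAt.inv ?_ ?_
  · exact (DifferentiableAt.const_mul (DifferentiableAt.const_cpow differentiableAt_id.neg
        (Or.inl (by exact_mod_cast hpp.ne_zero))) _).const_sub 1
  · have h34 := norm_character_mul_cpow_le_three_quarters χ hpp hs
    intro h0
    rw [← sub_eq_zero.1 h0, norm_one] at h34
    norm_num at h34

lemma sum_smoothSet_eq {q : ℕ} (χ : DirichletCharacter ℂ q) {x y : ℝ} (hy : 0 < y) :
    ∑ m ∈ smoothSet x y, χ (m : ZMod q) = ∑ n ∈ Finset.Icc 1 ⌊x⌋₊, smoothCoeff χ ⌊y⌋₊ n := by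
  unfold smoothSet
  rw [Finset.sum_filter]
  refine Finset.sum_congr rfl fun n hn => ?_
  unfold smoothCoeff
  congr 1
  rw [Nat.mem_smoothNumbers']
  refine propext (forall_congr' fun p => forall_congr' fun _ => forall_congr' fun _ => ?_)
  rw [Nat.lt_succ_iff, Nat.le_floor_iff hy.le]

/-- Under GRH, character sums over `y`-smooth numbers up to `x` are `O(x ^ (1/2 + ε))` uniformly for
all `y > 0`. -/
theorem exists_norm_sum_smoothSet_le (hGRH : GRH) {A ε : ℝ} (hA : 0 < A) (hε : 0 < ε) :
    ∃ C : ℝ, 0 < C ∧ ∀ x y : ℝ, 1 < x → 0 < y → ∀ q : ℕ, 1 < q → (q : ℝ) ≤ x ^ A →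
      ∀ χ : DirichletCharacter ℂ q, χ ≠ 1 →
        ‖∑ m ∈ smoothSet x y, χ (m : ZMod q)‖ ≤ C * x ^ (1 / 2 + ε) := by
  -- the exponents add up to `1/2 + 3η` (abscissa) `+ η` (Euler product) `+ η` (logarithm)
  set η := min (ε / 5) (1 / 8) with hηdef
  have hη : 0 < η := by positivity
  have hη1 : η ≤ 1 / 8 := min_le_right _ _
  have hηε : 5 * η ≤ ε := by have : η ≤ ε / 5 := min_le_left _ _; linarith
  set δ := η / (A + 3) with hδdef
  have hδ : 0 < δ := by positivity
  obtain ⟨K, hK, hPerron⟩ := exists_norm_sum_le_of_continuation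
  obtain ⟨C, hC, hEuler⟩ := exists_norm_eulerProduct_le hGRH hη (by linarith) hδ
  refine ⟨K * (1 + C * 3 ^ δ * (1 + 1 / η)), by positivity, fun x y hx hy q hq hqx χ hχ => ?_⟩
  have hx0 : 0 < x := by linarith
  rw [sum_smoothSet_eq χ hy]
  have hmain := hPerron (smoothCoeff χ ⌊y⌋₊)
    (fun s => ∏ p ∈ Nat.primesBelow (⌊y⌋₊ + 1), (1 - χ p * (p : ℂ) ^ (-s))⁻¹) (1 / 2 + 3 * η) x
    (C * 3 ^ δ * x ^ η) (norm_smoothCoeff_le χ _) (smoothCoeff_zero χ _) (by linarith) (by linarith)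
    hx.le (by positivity) (fun s hs => (LSeries_smoothCoeff χ _ (by rw [hs]; norm_num)).symm)
    (fun s hs _ _ => differentiableAt_eulerProduct χ _ (by linarith)) (fun s hs hs2 hsi => ?_)
  · have e1 : √x ≤ x ^ (1 / 2 + ε) := by
      rw [Real.sqrt_eq_rpow]
      exact Real.rpow_le_rpow_of_exponent_le hx.le (by linarith)
    have e2 : C * 3 ^ δ * x ^ η * x ^ (1 / 2 + 3 * η) * (1 + Real.log x) ≤
        C * 3 ^ δ * (1 + 1 / η) * x ^ (1 / 2 + ε) := by
      calc _ ≤ C * 3 ^ δ * x ^ η * x ^ (1 / 2 + 3 * η) * ((1 + 1 / η) * x ^ η) := by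
            gcongr; exact one_add_log_le hη hx.le
        _ = C * 3 ^ δ * (1 + 1 / η) * (x ^ η * x ^ (1 / 2 + 3 * η) * x ^ η) := by ring
        _ ≤ _ := by
            rw [← Real.rpow_add hx0, ← Real.rpow_add hx0]
            refine mul_le_mul_of_nonneg_left ?_ (by positivity)
            exact Real.rpow_le_rpow_of_exponent_le hx.le (by linarith)
    calc _ ≤ K * (x ^ (1 / 2 + ε) + C * 3 ^ δ * (1 + 1 / η) * x ^ (1 / 2 + ε)) :=
          hmain.trans (by gcongr)
      _ = _ := by ring
  · refine (hEuler q hq χ hχ s hs hs2 _).trans ?_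
    rw [mul_assoc]
    gcongr
    have hx3 : 1 ≤ x ^ 3 := one_le_pow₀ hx.le
    have hcond : conductor q s.im ≤ 3 * x ^ (A + 3) := by
      calc conductor q s.im ≤ x ^ A * (3 * x ^ 3) := by
            unfold conductor; gcongr; linarith
        _ = 3 * x ^ (A + 3) := by
            rw [Real.rpow_add hx0, show (3:ℝ) = ((3:ℕ):ℝ) by norm_num, Real.rpow_natCast]; ring
    calc conductor q s.im ^ δ ≤ (3 * x ^ (A + 3)) ^ δ :=
          Real.rpow_le_rpow (by linarith [four_le_conductor hq s.im]) hcond hδ.le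
      _ = 3 ^ δ * x ^ η := by
          rw [Real.mul_rpow (by norm_num) (by positivity), ← Real.rpow_mul hx0.le]
          congr 2
          rw [hδdef]; field_simp

end SmoothCharSum

theorem mainTheorem10 (hGRH : GRH) (A : ℝ) (hA : 0 < A) (c : ℝ) (hc : 0 < c)
    (ε : ℝ) (hε : 0 < ε) :
    ∃ C : ℝ, 0 < C ∧ ∀ x y : ℝ, 1 < x → 0 < y →
      c * (Real.log (Real.log x)) ^ 2 ≤ Real.log y →
      ∀ q : ℕ, 1 < q → (q : ℝ) ≤ x ^ A →
      ∀ χ : DirichletCharacter ℂ q, χ ≠ 1 →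
        ‖∑ m ∈ smoothSet x y, χ (m : ZMod q)‖ ≤ C * x ^ (1 / 2 + ε) := by
  obtain ⟨C, hC, h⟩ := SmoothCharSum.exists_norm_sum_smoothSet_le hGRH hA hε
  exact ⟨C, hC, fun x y hx hy _ q hq hqx χ hχ => h x y hx hy q hq hqx χ hχ⟩
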